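/- Let $a,b$ be real numbers with $0<a\le b$. For $n\ge b$ let $X=X^{(n)}$ be uniformly distributed on $\{0,1\}^n$ and let $Y$ be the graph of the sparse two-community stochastic block model: given $X$, each pair $\{i,j\}\subset[n]$ is independently an edge with probability $a/n$ if $X_i=X_j$ and with probability $b/n$ if $X_i\ne X_j$. Let $H^{(n)}(X|Y)$ be the conditional entropy of $X$ given $Y$. For $\gamma\ge b/2$ let $Y_\gamma$ be the output of $X$ through the graphical channel on the Poisson ensemble $\mathcal P_2(\gamma,n)$ with the kernel $$Q_\gamma(1|u_1,u_2)=\begin{cases} a/(2\gamma) & \text{if } u_1=u_2,\\ b/(2\gamma) & \text{if } u_1\ne u_2,\end{cases}\qquad Q_\gamma(0|u_1,u_2)=1-Q_\gamma(1|u_1,u_2);$$ that is, independently of $X$ draw a random multigraph $G$ in which the multiplicities $m_{ij}$ of the pairs $\{i,j\}\subset[n]$ are independent Poisson variables of mean $\gamma n/\binom n2$, and, given $G$ and $X$, attach to every copy of $\{i,j\}$ an independent output drawn from $Q_\gamma(\cdot|X_i,X_j)$. Let $H^{(n)}(X|Y_\gamma)=\mathbb E_G H^{(n)}_G(X|Y_\gamma)$,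 where $H^{(n)}_G(X|Y_\gamma)$ is the conditional entropy of $X$ given the outputs for the multigraph $G$. Then the limit of $\frac1n H^{(n)}(X|Y)$ as $n\to\infty$ exists, the limit of $\frac1n H^{(n)}(X|Y_\gamma)$ as $n\to\infty$ exists for all sufficiently large $\gamma$ (depending on $a,b$), the limit of the latter as $\gamma\to\infty$ exists, and $$\lim_{n\to\infty}\frac1n H^{(n)}(X|Y)=\lim_{\gamma\to\infty}\lim_{n\to\infty}\frac1n H^{(n)}(X|Y_\gamma).$$ -/

import Mathlib

open Filter Topology MeasureTheory

namespace PlantedGraph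

/-- The reverse channel (a posteriori distribution) `R(x|y) = P(y|x) |A|⁻¹ / S(y)`, where
`S(y) = ∑ x, P(y|x) |A|⁻¹`, for a channel `P` whose input is uniform on the finite set `A`. -/
noncomputable def reverseChannel {A B : Type*} [Fintype A] (P : A → B → ℝ) (y : B) (x : A) : ℝ :=
  P x y * (Fintype.card A : ℝ)⁻¹ / ∑ x' : A, P x' y * (Fintype.card A : ℝ)⁻¹

/-- Conditional entropy `H(X|Y)` in bits, for `X` uniform on `A` and `Y` the output of `X` through
the channel `P`.  (Terms with `P x y = 0` vanish, as usual.) -/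
noncomputable def condEntropy {A B : Type*} [Fintype A] [Fintype B] (P : A → B → ℝ) : ℝ :=
  -((Fintype.card A : ℝ)⁻¹ * ∑ x : A, ∑ y : B, P x y * Real.logb 2 (reverseChannel P y x))

/-- `E_k(V)` for `V = [n]`: the `k`-element subsets of the vertex set. -/
abbrev Edge (k n : ℕ) : Type := {I : Finset (Fin n) // I.card = k}

/-- `x[I]`: the node variables at the vertices of the hyperedge `I`, in increasing order of the
vertices. -/
def restrict {k n : ℕ} {𝒳 : Type*} (x : Fin n → 𝒳) (I : Edge k n) : Fin k → 𝒳 :=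
  fun i => x (I.1.orderEmbOfFin I.2 i)

/-- The graphical channel with kernel `Q` on the multi-hypergraph in which the hyperedge `I` has
multiplicity `m I`: each copy of `I` carries an independent output of `Q(·|x[I])`. -/
def graphicalChannel {k n : ℕ} {𝒳 𝒴 : Type*} (Q : (Fin k → 𝒳) → 𝒴 → ℝ) (m : Edge k n → ℕ)
    (x : Fin n → 𝒳) (y : (I : Edge k n) → Fin (m I) → 𝒴) : ℝ :=
  ∏ I : Edge k n, ∏ i : Fin (m I), Q (restrict x I) (y I i)

/-- The sparse Poisson ensemble `𝒫_k(α, n)` of random multi-hypergraphs on `[n]`: the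
multiplicities of the hyperedges are independent Poisson variables of mean `α n / (n choose k)`. -/
noncomputable def poissonEnsemble (k : ℕ) (α : ℝ) (n : ℕ) : Measure (Edge k n → ℕ) :=
  Measure.pi fun _ => ProbabilityTheory.poissonMeasure (α * n / n.choose k).toNNReal

/-- `H⁽ⁿ⁾(X|Y) = 𝔼_G H_G⁽ⁿ⁾(X|Y)` for the graphical channel with kernel `Q` on a random hypergraph
`G` from the ensemble `𝒫_k(α, n)`. -/
noncomputable def graphicalEntropy {k : ℕ} {𝒳 𝒴 : Type*} [Fintype 𝒳] [Fintype 𝒴]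
    (Q : (Fin k → 𝒳) → 𝒴 → ℝ) (α : ℝ) (n : ℕ) : ℝ :=
  ∫ m, condEntropy (graphicalChannel (n := n) Q m) ∂(poissonEnsemble k α n)

/-- The law on `{0, 1}` giving mass `p` to `1` and mass `1 - p` to `0`. -/
def bern (p : ℝ) (z : Fin 2) : ℝ := if z = 1 then p else 1 - p

/-- The two-community sparse stochastic block model: given the community assignment `x`, the edge
indicators `y` are independent, and the pair `{i, j}` is an edge with probability `a / n` if
`x i = x j` and `b / n` otherwise.  (The truncation at `1` matters only for the finitely many `n`
smaller than `a` or `b`, for which the model is not defined.) -/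
noncomputable def sbmChannel (a b : ℝ) (n : ℕ) (x : Fin n → Fin 2) (y : Edge 2 n → Fin 2) : ℝ :=
  ∏ I : Edge 2 n,
    bern (if restrict x I 0 = restrict x I 1 then min 1 (a / n) else min 1 (b / n)) (y I)

/-- `H⁽ⁿ⁾(X|Y)` for the stochastic block model: `X` is a uniform assignment and `Y` the graph. -/
noncomputable def sbmEntropy (a b : ℝ) (n : ℕ) : ℝ :=
  condEntropy (sbmChannel a b n)

/-- The SBM kernel: the output is `1` with probability `a / (2γ)` if the two inputs agree and
`b / (2γ)` if they differ.  Since `𝒫_2(γ, n)` puts on average `γ n / (n choose 2) ≈ 2γ / n` copies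
on each pair, a pair then carries a `1` with probability about `a / n`, resp. `b / n`. -/
noncomputable def sbmKernel (a b γ : ℝ) (u : Fin 2 → Fin 2) (z : Fin 2) : ℝ :=
  bern (if u 0 = u 1 then a / (2 * γ) else b / (2 * γ)) z

end PlantedGraph

/-!
A channel is encoded as the formal sum of its columns in the monoid algebra of `A → ℝ` under
pointwise multiplication (`FormalChannel`).  Independent observations multiply there, random
channels are convex combinations, and `|A|` times the conditional entropy extends to the linear
functional `entropy`.  A linear functional is bounded on channels once it is bounded on single
columns (`IsChannel.linear_le`), which reduces comparisons of product channels to the information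
that one more observation of a pair reveals about whether its two communities agree (`infoGain`).

Both models are compared with a third, in which every pair carries a single observation from the
kernel `Q_γ`, erased with probability `1 - copyProb γ n`; its entropy is `sparseEntropy`.

* Truncating the Poisson multiplicities at `1` changes the entropy by at most one bit per repeated
  pair, and the mean number of repeated pairs is bounded (`abs_integral_entropy_sub_sparse_le`).
* In the block model and in the erased model the outputs `1` of a pair have the same information up
  to `O(1 / n ^ 2)`.  By a `χ²` bound the outputs `0` have information `O(1 / n ^ 2)` and
  `O(1 / (γ n))`, respectively.  Summed over the pairs the difference is `O(1) + O(n / γ)`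
  (`abs_entropy_sbm_sub_sparse_le`).

So it remains to see that `sparseEntropy / n` converges for every large `γ`; the normalized entropy
of the block model is then a Cauchy sequence, and its limit is within `O(1 / γ)` of the limit
at `γ`.  Convergence follows from Fekete's lemma, as the entropy is subadditive in `n` up to a
constant (`exists_sparseEntropy_add_le`).  For this, the erasure rates are interpolated linearly
between the model on all vertices and the model on two separate blocks
(`entropy_prod_erasure_le`).  The derivative is a sum over pairs of the information about the pair.
Given a posterior in which the pair has correlation `m`, that information is an affine function of
`m` minus a power series in `m` with nonnegative coefficients from the second order on, because
`a ≤ b` and `(a + b) / (2 γ) ≤ 1` (`exists_hasSum_negMulLog`).  The linear term averages to zero,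
and the powers of the correlation matrix are positive semidefinite (`sum_mul_gram_pow_nonneg`), which
gives the derivative its sign (`sum_pairs_sub_le`).
-/

namespace PlantedGraph

open Real (negMulLog)

section Entropy

/-! ### Formal channels and their entropy -/

/-- A finite-output channel with input alphabet `A`, recorded as the formal sum of its columns
`P(·|y)`.  Independent use of two channels is the product of the algebra (the columns multiply
pointwise), and a channel drawn at random is a convex combination. -/
abbrev FormalChannel (A : Type*) : Type _ := MonoidAlgebra ℝ (A → ℝ)

variable {A : Type*}

/-- The contribution of a column `v` to the conditional entropy:
`∑ η(v x) - η(∑ v x)` with `η(t) = -t log t`. -/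
noncomputable def columnEntropy [Fintype A] (v : A → ℝ) : ℝ :=
  ∑ x, negMulLog (v x) - negMulLog (∑ x, v x)

/-- The linear extension of `columnEntropy`.  On a channel it is `|A|` times the conditional
entropy, in nats, of a uniform input given the output. -/
noncomputable def entropy [Fintype A] : FormalChannel A →ₗ[ℝ] ℝ :=
  Finsupp.linearCombination ℝ (columnEntropy (A := A)) ∘ₗ
    (MonoidAlgebra.coeffLinearEquiv ℝ).toLinearMap

/-- The sum of the columns, as an algebra homomorphism. -/
noncomputable def columnSum : FormalChannel A →ₐ[ℝ] (A → ℝ) :=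
  MonoidAlgebra.lift ℝ (A → ℝ) (A → ℝ) (MonoidHom.id _)

/-- The formal sums of nonnegative columns with nonnegative coefficients. -/
noncomputable def positiveCone (A : Type*) : AddSubmonoid (FormalChannel A) :=
  AddSubmonoid.closure {c | ∃ (v : A → ℝ) (r : ℝ), 0 ≤ v ∧ 0 ≤ r ∧ c = MonoidAlgebra.single v r}

/-- A formal sum of columns is a channel when it is nonnegative and its columns add up to `1`. -/
structure IsChannel (c : FormalChannel A) : Prop where
  mem_cone : c ∈ positiveCone A
  columnSum_eq : columnSum c = 1

@[simp] lemma entropy_single [Fintype A] (v : A → ℝ) (r : ℝ) :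
    entropy (MonoidAlgebra.single v r) = r * columnEntropy v := by
  simp [entropy, MonoidAlgebra.coeffLinearEquiv, Finsupp.linearCombination_single]

@[simp] lemma columnSum_single (v : A → ℝ) (r : ℝ) :
    columnSum (MonoidAlgebra.single v r) = r • v := by
  simp [columnSum, MonoidAlgebra.lift_single]

lemma single_mem_positiveCone {v : A → ℝ} (hv : 0 ≤ v) {r : ℝ} (hr : 0 ≤ r) :
    MonoidAlgebra.single v r ∈ positiveCone A :=
  AddSubmonoid.subset_closure ⟨v, r, hv, hr, rfl⟩

lemma mul_mem_positiveCone {c d : FormalChannel A} (hc : c ∈ positiveCone A)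
    (hd : d ∈ positiveCone A) : c * d ∈ positiveCone A := by
  induction hc using AddSubmonoid.closure_induction with
  | mem c hc =>
    obtain ⟨v, r, hv, hr, rfl⟩ := hc
    induction hd using AddSubmonoid.closure_induction with
    | mem d hd =>
      obtain ⟨w, s, hw, hs, rfl⟩ := hd
      rw [MonoidAlgebra.single_mul_single]
      exact single_mem_positiveCone (mul_nonneg hv hw) (mul_nonneg hr hs)
    | zero => simp
    | add x y _ _ hx hy => rw [mul_add]; exact add_mem hx hy
  | zero => simp
  | add x y _ _ hx hy => rw [add_mul]; exact add_mem hx hy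

lemma smul_mem_positiveCone {c : FormalChannel A} (hc : c ∈ positiveCone A) {t : ℝ}
    (ht : 0 ≤ t) : t • c ∈ positiveCone A := by
  induction hc using AddSubmonoid.closure_induction with
  | mem c hc =>
    obtain ⟨v, r, hv, hr, rfl⟩ := hc
    rw [MonoidAlgebra.smul_single]
    exact single_mem_positiveCone hv (mul_nonneg ht hr)
  | zero => simp
  | add x y _ _ hx hy => rw [smul_add]; exact add_mem hx hy

lemma IsChannel.one : IsChannel (1 : FormalChannel A) where
  mem_cone := by
    rw [MonoidAlgebra.one_def]
    exact single_mem_positiveCone zero_le_one zero_le_one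
  columnSum_eq := map_one _

lemma IsChannel.mul {c d : FormalChannel A} (hc : IsChannel c) (hd : IsChannel d) :
    IsChannel (c * d) where
  mem_cone := mul_mem_positiveCone hc.mem_cone hd.mem_cone
  columnSum_eq := by rw [map_mul, hc.columnSum_eq, hd.columnSum_eq, one_mul]

lemma IsChannel.prod {ι : Type*} (s : Finset ι) {c : ι → FormalChannel A}
    (hc : ∀ i ∈ s, IsChannel (c i)) : IsChannel (∏ i ∈ s, c i) :=
  Finset.prod_induction _ _ (fun _ _ => IsChannel.mul) IsChannel.one hc

lemma IsChannel.pow {c : FormalChannel A} (hc : IsChannel c) (n : ℕ) : IsChannel (c ^ n) := by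
  simpa using IsChannel.prod (Finset.range n) (c := fun _ => c) fun _ _ => hc

/-- The channel `c` behind an erasure of probability `1 - t`. -/
noncomputable def erasure (t : ℝ) (c : FormalChannel A) : FormalChannel A := 1 + t • (c - 1)

lemma IsChannel.erasure {c : FormalChannel A} (hc : IsChannel c) {t : ℝ} (h0 : 0 ≤ t)
    (h1 : t ≤ 1) : IsChannel (erasure t c) where
  mem_cone := by
    have : PlantedGraph.erasure t c = (1 - t) • 1 + t • c := by
      rw [PlantedGraph.erasure, smul_sub, sub_smul, one_smul]; abel
    rw [this]
    exact add_mem (smul_mem_positiveCone IsChannel.one.mem_cone (by linarith))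
      (smul_mem_positiveCone hc.mem_cone h0)
  columnSum_eq := by simp [PlantedGraph.erasure, hc.columnSum_eq]

lemma cone_linear_le {f g : FormalChannel A →ₗ[ℝ] ℝ}
    (h : ∀ v : A → ℝ, 0 ≤ v → f (MonoidAlgebra.single v 1) ≤ g (MonoidAlgebra.single v 1))
    {c : FormalChannel A} (hc : c ∈ positiveCone A) : f c ≤ g c := by
  induction hc using AddSubmonoid.closure_induction with
  | mem c hc =>
    obtain ⟨v, r, hv, hr, rfl⟩ := hc
    have : MonoidAlgebra.single v r = r • MonoidAlgebra.single v (1 : ℝ) := by simp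
    rw [this, map_smul, map_smul]
    exact mul_le_mul_of_nonneg_left (h v hv) hr
  | zero => simp
  | add x y _ _ hx hy => rw [map_add, map_add]; exact add_le_add hx hy

/-- The channel whose output has law `α` if the input satisfies `p`, and law `β` otherwise. -/
noncomputable def statChannel {Z : Type*} [Fintype Z] (p : A → Prop) [DecidablePred p]
    (α β : Z → ℝ) : FormalChannel A :=
  ∑ z, MonoidAlgebra.single (fun x => if p x then α z else β z) 1

lemma isChannel_statChannel {Z : Type*} [Fintype Z] (p : A → Prop) [DecidablePred p]
    {α β : Z → ℝ} (hα : ∀ z, 0 ≤ α z) (hβ : ∀ z, 0 ≤ β z) (sα : ∑ z, α z = 1)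
    (sβ : ∑ z, β z = 1) : IsChannel (statChannel p α β) where
  mem_cone := sum_mem fun z _ => single_mem_positiveCone
    (fun x => by by_cases h : p x <;> simp [h, hα, hβ]) zero_le_one
  columnSum_eq := by
    ext x
    by_cases h : p x <;> simp [statChannel, h, sα, sβ]

variable [Fintype A]

/-- A linear functional is controlled on channels by its values on single nonnegative columns. -/
lemma IsChannel.linear_le {f : FormalChannel A →ₗ[ℝ] ℝ} {ε : ℝ}
    (h : ∀ v : A → ℝ, 0 ≤ v → f (MonoidAlgebra.single v 1) ≤ ε * ∑ x, v x)
    {c : FormalChannel A} (hc : IsChannel c) : f c ≤ ε * Fintype.card A := by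
  let s : (A → ℝ) →ₗ[ℝ] ℝ := ∑ x, LinearMap.proj x
  have := cone_linear_le (f := f) (g := ε • (s ∘ₗ columnSum.toLinearMap))
    (fun v hv => by simpa [s] using h v hv) hc.mem_cone
  simpa [s, hc.columnSum_eq] using this

/-! ### Channels that see one binary statistic of the input -/

/-- `(u + w)` times the `η`-Jensen gap of the values `α`, `β` under the weights `u`, `w`: the
contribution of an output symbol of likelihoods `α`, `β` to the information gained about a binary
statistic of weights `u`, `w`. -/
noncomputable def infoGain (u w α β : ℝ) : ℝ :=
  (u + w) * negMulLog ((u * α + w * β) / (u + w)) - u * negMulLog α - w * negMulLog β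

lemma infoGain_nonneg {u w α β : ℝ} (hu : 0 ≤ u) (hw : 0 ≤ w) (hα : 0 ≤ α) (hβ : 0 ≤ β) :
    0 ≤ infoGain u w α β := by
  rcases (add_nonneg hu hw).eq_or_lt with h | h
  · obtain rfl : u = 0 := by linarith
    obtain rfl : w = 0 := by linarith
    simp [infoGain]
  · have := Real.concaveOn_negMulLog.2 (Set.mem_Ici.2 hα) (Set.mem_Ici.2 hβ)
      (div_nonneg hu h.le) (div_nonneg hw h.le) (by field_simp)
    simp only [smul_eq_mul] at this
    have h2 : u / (u + w) * α + w / (u + w) * β = (u * α + w * β) / (u + w) := by ring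
    rw [h2] at this
    have := mul_le_mul_of_nonneg_left this h.le
    have h3 : (u + w) * (u / (u + w) * negMulLog α + w / (u + w) * negMulLog β)
      = u * negMulLog α + w * negMulLog β := by field_simp
    unfold infoGain
    linarith

lemma add_mul_div_eq {u w : ℝ} (hu : 0 ≤ u) (hw : 0 ≤ w) (α β : ℝ) :
    (u + w) * ((u * α + w * β) / (u + w)) = u * α + w * β := by
  rcases (add_nonneg hu hw).eq_or_lt with h | h
  · obtain rfl : u = 0 := by linarith
    obtain rfl : w = 0 := by linarith
    simp
  · field_simp

lemma infoGain_smul {u w : ℝ} (hu : 0 ≤ u) (hw : 0 ≤ w) (c α β : ℝ) :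
    infoGain u w (c * α) (c * β) = c * infoGain u w α β := by
  have h := add_mul_div_eq hu hw α β
  have h2 : (u * (c * α) + w * (c * β)) / (u + w) = c * ((u * α + w * β) / (u + w)) := by ring
  simp only [infoGain, h2, Real.negMulLog_mul]
  linear_combination negMulLog c * h

/-- The bound of relative entropy by the `χ²` distance. -/
lemma infoGain_le {u w α β m : ℝ} (hu : 0 ≤ u) (hw : 0 ≤ w) (hm : 0 < m) (hα : m ≤ α)
    (hβ : m ≤ β) : infoGain u w α β ≤ (α - β) ^ 2 / m * (u + w) := by
  rcases (add_nonneg hu hw).eq_or_lt with h | h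
  · obtain rfl : u = 0 := by linarith
    obtain rfl : w = 0 := by linarith
    simp [infoGain]
  set r := (u * α + w * β) / (u + w) with hr
  have hrm : m ≤ r := by
    rw [hr, le_div_iff₀ h]; nlinarith
  have hr0 : 0 < r := hm.trans_le hrm
  have hα0 : 0 < α := hm.trans_le hα
  have hβ0 : 0 < β := hm.trans_le hβ
  have e : (u + w) * r = u * α + w * β := add_mul_div_eq hu hw α β
  have l1 : Real.log α - Real.log r ≤ α / r - 1 := by
    rw [← Real.log_div hα0.ne' hr0.ne']; exact Real.log_le_sub_one_of_pos (by positivity)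
  have l2 : Real.log β - Real.log r ≤ β / r - 1 := by
    rw [← Real.log_div hβ0.ne' hr0.ne']; exact Real.log_le_sub_one_of_pos (by positivity)
  have e1 : infoGain u w α β
      = u * α * (Real.log α - Real.log r) + w * β * (Real.log β - Real.log r) := by
    simp only [infoGain, ← hr, negMulLog]
    linear_combination -Real.log r * e
  have e2 : infoGain u w α β ≤ u * α * (α / r - 1) + w * β * (β / r - 1) := by
    rw [e1]; gcongr
  have e3 : u * α * (α / r - 1) + w * β * (β / r - 1) = u * w * (α - β) ^ 2 / ((u + w) * r) := by
    rw [e]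
    have : u * α + w * β ≠ 0 := by rw [← e]; positivity
    rw [hr]; field_simp; ring
  rw [e3] at e2
  refine e2.trans ?_
  rw [div_mul_eq_mul_div, div_le_div_iff₀ (by positivity) hm]
  have : u * w ≤ (u + w) * (u + w) := by nlinarith
  calc u * w * (α - β) ^ 2 * m ≤ ((u + w) * (u + w)) * (α - β) ^ 2 * r := by gcongr
    _ = _ := by ring

lemma negMulLog_add_le {x y : ℝ} (hx : 0 ≤ x) (hy : 0 ≤ y) :
    negMulLog (x + y) ≤ negMulLog x + negMulLog y := by
  rcases hx.eq_or_lt with rfl | hx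
  · simp
  rcases hy.eq_or_lt with rfl | hy
  · simp
  have h1 : Real.log x ≤ Real.log (x + y) := Real.log_le_log hx (by linarith)
  have h2 : Real.log y ≤ Real.log (x + y) := Real.log_le_log hy (by linarith)
  simp only [negMulLog]
  nlinarith

/-- A binary statistic carries at most one bit. -/
lemma sum_infoGain_le {Z : Type*} [Fintype Z] {u w : ℝ} (hu : 0 ≤ u) (hw : 0 ≤ w)
    {α β : Z → ℝ} (hα : ∀ z, 0 ≤ α z) (hβ : ∀ z, 0 ≤ β z) (sα : ∑ z, α z = 1)
    (sβ : ∑ z, β z = 1) : ∑ z, infoGain u w (α z) (β z) ≤ Real.log 2 * (u + w) := by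
  rcases (add_nonneg hu hw).eq_or_lt with h | h
  · obtain rfl : u = 0 := by linarith
    obtain rfl : w = 0 := by linarith
    simp [infoGain]
  have key : ∀ z, infoGain u w (α z) (β z) ≤ α z * negMulLog u + β z * negMulLog w
      - (u * α z + w * β z) / (u + w) * negMulLog (u + w) := by
    intro z
    have h1 := negMulLog_add_le (mul_nonneg hu (hα z)) (mul_nonneg hw (hβ z))
    have h2 := add_mul_div_eq hu hw (α z) (β z)
    rw [← h2, Real.negMulLog_mul, Real.negMulLog_mul, Real.negMulLog_mul] at h1
    unfold infoGain
    linarith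
  refine (Finset.sum_le_sum fun z _ => key z).trans ?_
  rw [Finset.sum_sub_distrib, Finset.sum_add_distrib, ← Finset.sum_mul, ← Finset.sum_mul,
    ← Finset.sum_mul, ← Finset.sum_div, Finset.sum_add_distrib, ← Finset.mul_sum,
    ← Finset.mul_sum, sα, sβ, mul_one, mul_one, div_self h.ne']
  have h3 := Real.concaveOn_negMulLog.2 (Set.mem_Ici.2 hu) (Set.mem_Ici.2 hw)
    (show (0 : ℝ) ≤ 1 / 2 by norm_num) (show (0 : ℝ) ≤ 1 / 2 by norm_num) (by norm_num)
  simp only [smul_eq_mul] at h3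
  have h4 : negMulLog (1 / 2 * u + 1 / 2 * w)
      = (u + w) * (1 / 2 * Real.log 2) + 1 / 2 * negMulLog (u + w) := by
    rw [show 1 / 2 * u + 1 / 2 * w = (1 / 2) * (u + w) by ring, Real.negMulLog_mul]
    congr 2
    rw [negMulLog, one_div, Real.log_inv]; ring
  rw [h4] at h3
  linarith

/-- The weight that `v` gives to the inputs satisfying `p`. -/
def weightOf (p : A → Prop) [DecidablePred p] (v : A → ℝ) : ℝ := ∑ x, if p x then v x else 0

lemma weightOf_nonneg (p : A → Prop) [DecidablePred p] {v : A → ℝ} (hv : 0 ≤ v) :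
    0 ≤ weightOf p v :=
  Finset.sum_nonneg fun x _ => by split_ifs; exacts [hv x, le_rfl]

lemma weightOf_add_not (p : A → Prop) [DecidablePred p] (v : A → ℝ) :
    weightOf p v + weightOf (fun x => ¬ p x) v = ∑ x, v x := by
  rw [weightOf, weightOf, ← Finset.sum_add_distrib]
  exact Finset.sum_congr rfl fun x _ => by by_cases h : p x <;> simp [h]

lemma sum_mul_ite (p : A → Prop) [DecidablePred p] (v : A → ℝ) (s t : ℝ) :
    ∑ x, v x * (if p x then s else t) = weightOf p v * s + weightOf (fun x => ¬ p x) v * t := by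
  rw [weightOf, weightOf, Finset.sum_mul, Finset.sum_mul, ← Finset.sum_add_distrib]
  exact Finset.sum_congr rfl fun x _ => by by_cases h : p x <;> simp [h]

/-- The information revealed by a channel that sees only the statistic `p`. -/
lemma entropy_single_mul_statChannel {Z : Type*} [Fintype Z] (p : A → Prop) [DecidablePred p]
    {α β : Z → ℝ} (sα : ∑ z, α z = 1) (sβ : ∑ z, β z = 1) {v : A → ℝ} (hv : 0 ≤ v) :
    entropy (MonoidAlgebra.single v 1 * (statChannel p α β - 1)) =
      -∑ z, infoGain (weightOf p v) (weightOf (fun x => ¬ p x) v) (α z) (β z) := by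
  set u := weightOf p v with hu
  set w := weightOf (fun x => ¬ p x) v with hw
  have huw : ∑ x, v x = u + w := (weightOf_add_not p v).symm
  have e1 : MonoidAlgebra.single v (1 : ℝ) * statChannel p α β
      = ∑ z, MonoidAlgebra.single (fun x => v x * if p x then α z else β z) 1 := by
    rw [statChannel, Finset.mul_sum]
    refine Finset.sum_congr rfl fun z _ => ?_
    rw [MonoidAlgebra.single_mul_single, one_mul]
    rfl
  have e2 : ∀ z, columnEntropy (fun x => v x * if p x then α z else β z)
      = (∑ x, (if p x then α z else β z) * negMulLog (v x)) + u * negMulLog (α z)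
        + w * negMulLog (β z) - ((u * α z + w * β z) / (u + w) * negMulLog (u + w)
          + (u + w) * negMulLog ((u * α z + w * β z) / (u + w))) := by
    intro z
    have h1 := congrArg negMulLog
      (add_mul_div_eq (weightOf_nonneg p hv) (weightOf_nonneg (fun x => ¬ p x) hv) (α z) (β z))
    rw [Real.negMulLog_mul] at h1
    rw [columnEntropy, sum_mul_ite, ← h1, add_assoc (∑ x, _)]
    have h2 : u * negMulLog (α z) + w * negMulLog (β z)
        = ∑ x, v x * negMulLog (if p x then α z else β z) := by
      rw [hu, hw, ← sum_mul_ite]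
      exact Finset.sum_congr rfl fun x _ => by by_cases h : p x <;> simp [h]
    rw [h2, ← Finset.sum_add_distrib]
    congr 1
    refine Finset.sum_congr rfl fun x _ => ?_
    rw [Real.negMulLog_mul]
  have e3 : ∑ z, ∑ x, (if p x then α z else β z) * negMulLog (v x) = ∑ x, negMulLog (v x) := by
    rw [Finset.sum_comm]
    refine Finset.sum_congr rfl fun x _ => ?_
    by_cases h : p x <;> simp [h, ← Finset.sum_mul, sα, sβ]
  have e4 : ∑ z, (u * α z + w * β z) / (u + w) * negMulLog (u + w) = negMulLog (u + w) := by
    rw [← Finset.sum_mul, ← Finset.sum_div, Finset.sum_add_distrib, ← Finset.mul_sum,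
      ← Finset.mul_sum, sα, sβ, mul_one, mul_one]
    by_cases h : u + w = 0
    · simp [h]
    · rw [div_self h, one_mul]
  rw [mul_sub, mul_one, map_sub, e1, map_sum]
  simp only [entropy_single, one_mul, e2]
  rw [columnEntropy, huw]
  simp only [infoGain, Finset.sum_sub_distrib, Finset.sum_add_distrib, e3, e4]
  ring

/-- An observation of a binary statistic lowers the entropy, by at most one bit. -/
lemma entropy_mul_statChannel_sub_one {Z : Type*} [Fintype Z] (p : A → Prop) [DecidablePred p]
    {α β : Z → ℝ} (hα : ∀ z, 0 ≤ α z) (hβ : ∀ z, 0 ≤ β z) (sα : ∑ z, α z = 1)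
    (sβ : ∑ z, β z = 1) {c : FormalChannel A} (hc : IsChannel c) :
    entropy (c * (statChannel p α β - 1)) ≤ 0 ∧
      -(Real.log 2 * Fintype.card A) ≤ entropy (c * (statChannel p α β - 1)) := by
  let f : FormalChannel A →ₗ[ℝ] ℝ := entropy ∘ₗ LinearMap.mulRight ℝ (statChannel p α β - 1)
  constructor
  · have := hc.linear_le (f := f) (ε := 0) fun v hv => by
      simp only [f, LinearMap.comp_apply, LinearMap.mulRight_apply,
        entropy_single_mul_statChannel p sα sβ hv, zero_mul, neg_nonpos]
      exact Finset.sum_nonneg fun z _ => infoGain_nonneg (weightOf_nonneg p hv)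
        (weightOf_nonneg _ hv) (hα z) (hβ z)
    simpa [f] using this
  · have := hc.linear_le (f := -f) (ε := Real.log 2) fun v hv => by
      simp only [f, LinearMap.neg_apply, LinearMap.comp_apply, LinearMap.mulRight_apply,
        entropy_single_mul_statChannel p sα sβ hv, neg_neg]
      rw [← weightOf_add_not p v]
      exact sum_infoGain_le (weightOf_nonneg p hv) (weightOf_nonneg _ hv) hα hβ sα sβ
    simp only [f, LinearMap.neg_apply, LinearMap.comp_apply, LinearMap.mulRight_apply] at this
    linarith

end Entropy

/-! ### Channels as formal channels -/

section Formal

variable {A : Type*}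

/-- The formal sum of the columns of a channel. -/
noncomputable def formal {B : Type*} [Fintype B] (P : A → B → ℝ) : FormalChannel A :=
  ∑ y, MonoidAlgebra.single (fun x => P x y) 1

lemma formal_prod {ι : Type*} [Fintype ι] [DecidableEq ι] {B : ι → Type*} [∀ i, Fintype (B i)]
    (K : ∀ i, A → B i → ℝ) :
    formal (fun x (y : ∀ i, B i) => ∏ i, K i x (y i)) = ∏ i, formal (K i) := by
  have h : ∀ i (z : B i), MonoidAlgebra.single (fun x => K i x z) (1 : ℝ)
      = MonoidAlgebra.of ℝ (A → ℝ) fun x => K i x z := fun _ _ => rfl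
  simp only [formal, h]
  rw [Finset.prod_univ_sum, Fintype.piFinset_univ]
  refine Finset.sum_congr rfl fun y _ => ?_
  rw [← map_prod]
  congr 1
  ext x
  simp [Finset.prod_apply]

lemma formal_eq_statChannel {B : Type*} [Fintype B] (p : A → Prop) [DecidablePred p]
    (α β : B → ℝ) : formal (fun x y => if p x then α y else β y) = statChannel p α β := rfl

variable [Fintype A]

/-- The entropy of a channel, in bits, from that of its formal sum of columns, in nats. -/
lemma condEntropy_eq_entropy {B : Type*} [Fintype B] {P : A → B → ℝ}
    (hP : ∀ x y, 0 ≤ P x y) :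
    condEntropy P = entropy (formal P) / (Fintype.card A * Real.log 2) := by
  have h : ∀ y x, P x y * Real.logb 2 (reverseChannel P y x)
      = (P x y * Real.log (P x y) - P x y * Real.log (∑ x', P x' y)) / Real.log 2 := by
    intro y x
    rcases (hP x y).eq_or_lt with h0 | h0
    · simp [← h0]
    have hc : (Fintype.card A : ℝ)⁻¹ ≠ 0 :=
      inv_ne_zero (Nat.cast_ne_zero.2 (Fintype.card_pos_iff.2 ⟨x⟩).ne')
    have hs : 0 < ∑ x', P x' y :=
      h0.trans_le (Finset.single_le_sum (fun i _ => hP i y) (Finset.mem_univ x))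
    rw [reverseChannel, ← Finset.sum_mul, mul_div_mul_right _ _ hc, Real.logb,
      Real.log_div h0.ne' hs.ne']
    ring
  have h2 : ∀ y, columnEntropy (fun x => P x y)
      = -∑ x, (P x y * Real.log (P x y) - P x y * Real.log (∑ x', P x' y)) := by
    intro y
    simp only [columnEntropy, negMulLog, Finset.sum_sub_distrib, ← Finset.sum_mul, neg_mul,
      Finset.sum_neg_distrib]
    ring
  rw [condEntropy, formal, map_sum, Finset.sum_comm]
  simp only [h, entropy_single, one_mul, h2, ← Finset.sum_div, Finset.sum_neg_distrib]
  rw [div_mul_eq_div_div_swap, neg_div, neg_div, div_eq_inv_mul _ (Fintype.card A : ℝ)]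

/-- Replacing the factors of a product channel one at a time. -/
lemma entropy_mul_prod_le {ι : Type*} (s : Finset ι) {K K' : ι → FormalChannel A} {ε : ι → ℝ}
    (hK : ∀ i ∈ s, IsChannel (K i)) (hK' : ∀ i ∈ s, IsChannel (K' i))
    (h : ∀ i ∈ s, ∀ c, IsChannel c →
      entropy (c * K i) ≤ entropy (c * K' i) + ε i * Fintype.card A)
    {c : FormalChannel A} (hc : IsChannel c) :
    entropy (c * ∏ i ∈ s, K i) ≤ entropy (c * ∏ i ∈ s, K' i) + (∑ i ∈ s, ε i) * Fintype.card A := by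
  classical
  induction s using Finset.induction_on generalizing c with
  | empty => simp
  | insert i s hi ih =>
    rw [Finset.prod_insert hi, Finset.prod_insert hi, Finset.sum_insert hi]
    have h1 := ih (fun j hj => hK j (Finset.mem_insert_of_mem hj))
      (fun j hj => hK' j (Finset.mem_insert_of_mem hj))
      (fun j hj => h j (Finset.mem_insert_of_mem hj))
      (hc.mul (hK i (Finset.mem_insert_self i s)))
    have h2 := h i (Finset.mem_insert_self i s) (c * ∏ j ∈ s, K' j)
      (hc.mul (IsChannel.prod s fun j hj => hK' j (Finset.mem_insert_of_mem hj)))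
    rw [mul_assoc] at h1
    have e1 : c * K i * ∏ j ∈ s, K' j = c * (∏ j ∈ s, K' j) * K i := by ring
    have e2 : c * (∏ j ∈ s, K' j) * K' i = c * (K' i * ∏ j ∈ s, K' j) := by ring
    rw [e1] at h1
    rw [e2] at h2
    linarith

end Formal

/-! ### Pair channels -/

section Pair

variable {V : Type*}

/-- The assignment `x` is constant on `I`. -/
def Agree (I : Finset V) (x : V → Fin 2) : Prop := ∀ i ∈ I, ∀ j ∈ I, x i = x j

instance (I : Finset V) : DecidablePred (Agree I) := fun x => by unfold Agree; infer_instance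

/-- One observation of the pair `I`: a `1` with probability `α` if the communities of its vertices
agree and with probability `β` if they differ. -/
noncomputable def pairChannel (α β : ℝ) (I : Finset V) : FormalChannel (V → Fin 2) :=
  statChannel (Agree I) (bern α) (bern β)

lemma bern_nonneg {p : ℝ} (h0 : 0 ≤ p) (h1 : p ≤ 1) (z : Fin 2) : 0 ≤ bern p z := by
  unfold bern; split_ifs <;> linarith

lemma sum_bern (p : ℝ) : ∑ z, bern p z = 1 := by simp [bern]

lemma isChannel_pairChannel {α β : ℝ} (hα : 0 ≤ α) (hα1 : α ≤ 1) (hβ : 0 ≤ β) (hβ1 : β ≤ 1)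
    (I : Finset V) : IsChannel (pairChannel α β I) :=
  isChannel_statChannel _ (bern_nonneg hα hα1) (bern_nonneg hβ hβ1) (sum_bern _) (sum_bern _)

lemma restrict_eq_iff_agree {n : ℕ} (x : Fin n → Fin 2) (I : Edge 2 n) :
    restrict x I 0 = restrict x I 1 ↔ Agree I.1 x := by
  have hm : ∀ i, I.1.orderEmbOfFin I.2 i ∈ I.1 := I.1.orderEmbOfFin_mem I.2
  constructor
  · intro h i hi j hj
    have hr : ∀ i ∈ I.1, x i = restrict x I 0 := by
      intro i hi
      have : i ∈ Set.range (I.1.orderEmbOfFin I.2) := by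
        rw [Finset.range_orderEmbOfFin]; exact hi
      obtain ⟨k, rfl⟩ := this
      have : ∀ k, restrict x I k = restrict x I 0 := by
        rw [Fin.forall_fin_two]; exact ⟨rfl, h.symm⟩
      exact this k
    rw [hr i hi, hr j hj]
  · intro h
    exact h _ (hm 0) _ (hm 1)

lemma sbmEntropy_eq {a b : ℝ} (ha : 0 < a) (hab : a ≤ b) {n : ℕ} (hn : b ≤ n) :
    sbmEntropy a b n = entropy (∏ I : Edge 2 n, pairChannel (a / n) (b / n) I.1)
      / (2 ^ n * Real.log 2) := by
  have hn0 : (0 : ℝ) < n := by linarith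
  have ha1 : a / n ≤ 1 := (div_le_one hn0).2 (by linarith)
  have hb1 : b / n ≤ 1 := (div_le_one hn0).2 hn
  have ha0 : 0 ≤ a / n := by positivity
  have hb0 : 0 ≤ b / n := div_nonneg (by linarith) hn0.le
  have hP : sbmChannel a b n = fun x y => ∏ I : Edge 2 n,
      (fun x z => if Agree I.1 x then bern (a / n) z else bern (b / n) z) x (y I) := by
    ext x y
    refine Finset.prod_congr rfl fun I _ => ?_
    simp only [restrict_eq_iff_agree, min_eq_right ha1, min_eq_right hb1]
    split_ifs <;> rfl
  rw [sbmEntropy, condEntropy_eq_entropy, hP, formal_prod (fun (I : Edge 2 n) x z =>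
    if Agree I.1 x then bern (a / n) z else bern (b / n) z)]
  · simp only [formal_eq_statChannel, Fintype.card_pi, Fintype.card_fin, Finset.prod_const,
      Finset.card_univ, Nat.cast_pow, Nat.cast_ofNat]
    rfl
  · intro x y
    rw [hP]
    exact Finset.prod_nonneg fun I _ => by
      dsimp only; split_ifs
      exacts [bern_nonneg ha0 ha1 _, bern_nonneg hb0 hb1 _]

lemma formal_graphicalChannel {n : ℕ} (a b γ : ℝ) (m : Edge 2 n → ℕ) :
    formal (graphicalChannel (sbmKernel a b γ) m)
      = ∏ I : Edge 2 n, pairChannel (a / (2 * γ)) (b / (2 * γ)) I.1 ^ m I := by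
  refine (formal_prod fun (I : Edge 2 n) x (z : Fin (m I) → Fin 2) =>
    ∏ i, sbmKernel a b γ (restrict x I) (z i)).trans ?_
  refine Finset.prod_congr rfl fun I _ => ?_
  rw [formal_prod (fun (_ : Fin (m I)) x z => sbmKernel a b γ (restrict x I) z),
    Finset.prod_const, Finset.card_univ, Fintype.card_fin]
  congr 1
  rw [pairChannel, ← formal_eq_statChannel]
  congr 1
  ext x z
  simp only [sbmKernel, restrict_eq_iff_agree]
  split_ifs <;> rfl

lemma condEntropy_graphicalChannel {a b γ : ℝ} (ha : 0 < a) (hab : a ≤ b) (hγ : b ≤ 2 * γ) {n : ℕ}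
    (m : Edge 2 n → ℕ) :
    condEntropy (graphicalChannel (sbmKernel a b γ) m)
      = entropy (∏ I : Edge 2 n, pairChannel (a / (2 * γ)) (b / (2 * γ)) I.1 ^ m I)
        / (2 ^ n * Real.log 2) := by
  have hg : 0 < 2 * γ := by linarith
  rw [condEntropy_eq_entropy, formal_graphicalChannel]
  · simp
  · intro x y
    refine Finset.prod_nonneg fun I _ => Finset.prod_nonneg fun i _ => bern_nonneg ?_ ?_ _
    · split_ifs
      exacts [by positivity, div_nonneg (by linarith) hg.le]
    · split_ifs
      exacts [(div_le_one hg).2 (by linarith), (div_le_one hg).2 hγ]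

lemma sum_infoGain_bern (u w α β : ℝ) : ∑ z, infoGain u w (bern α z) (bern β z)
    = infoGain u w α β + infoGain u w (1 - α) (1 - β) := by
  rw [Fin.sum_univ_two, add_comm]; simp [bern]

variable [Fintype V] [DecidableEq V]

/-- Nearly all information of a sparse observation is in its outputs `1`, and these carry the same
information about a pair in a Bernoulli observation of parameters `a / N`, `b / N` as in an erased
one whose rate of `1`s is the same. -/
lemma abs_entropy_mul_sub_le {a b γ N t : ℝ} (ha : 0 < a) (hab : a ≤ b) (hN : 2 * b ≤ N)
    (hγ : b ≤ γ) (ht : 0 ≤ t) (I : Finset V) {c : FormalChannel (V → Fin 2)} (hc : IsChannel c) :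
    |entropy (c * (pairChannel (a / N) (b / N) I
        - erasure t (pairChannel (a / (2 * γ)) (b / (2 * γ)) I)))|
      ≤ (|N⁻¹ - t / (2 * γ)| * ((a - b) ^ 2 / a) + 2 * ((a - b) / N) ^ 2
          + t * (2 * ((a - b) / (2 * γ)) ^ 2)) * Fintype.card (V → Fin 2) := by
  have hN0 : 0 < N := by linarith
  have hg0 : 0 < 2 * γ := by linarith
  set ε := |N⁻¹ - t / (2 * γ)| * ((a - b) ^ 2 / a) + 2 * ((a - b) / N) ^ 2
          + t * (2 * ((a - b) / (2 * γ)) ^ 2) with hε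
  let f : FormalChannel (V → Fin 2) →ₗ[ℝ] ℝ := entropy ∘ₗ LinearMap.mulRight ℝ
    (pairChannel (a / N) (b / N) I - erasure t (pairChannel (a / (2 * γ)) (b / (2 * γ)) I))
  have key : ∀ v : (V → Fin 2) → ℝ, 0 ≤ v →
      |f (MonoidAlgebra.single v 1)| ≤ ε * ∑ x, v x := by
    intro v hv
    have hu := weightOf_nonneg (Agree I) hv
    have hw := weightOf_nonneg (fun x => ¬ Agree I x) hv
    have e1 : f (MonoidAlgebra.single v 1)
        = entropy (MonoidAlgebra.single v 1 * (pairChannel (a / N) (b / N) I - 1))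
        - t * entropy (MonoidAlgebra.single v 1 *
            (pairChannel (a / (2 * γ)) (b / (2 * γ)) I - 1)) := by
      rw [← smul_eq_mul t, ← map_smul, ← map_sub, ← mul_smul_comm, ← mul_sub]
      simp only [f, LinearMap.comp_apply, LinearMap.mulRight_apply, erasure, sub_sub]
    have e2 := entropy_single_mul_statChannel (Agree I) (sum_bern (a / N)) (sum_bern (b / N)) hv
    have e3 := entropy_single_mul_statChannel (Agree I) (sum_bern (a / (2 * γ)))
      (sum_bern (b / (2 * γ))) hv
    rw [e1, pairChannel, e2, pairChannel, e3, ← weightOf_add_not (Agree I) v, sum_infoGain_bern,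
      sum_infoGain_bern]
    set u := weightOf (Agree I) v
    set w := weightOf (fun x => ¬ Agree I x) v
    have s1 : infoGain u w (a / N) (b / N) = N⁻¹ * infoGain u w a b := by
      rw [← infoGain_smul hu hw, div_eq_inv_mul, div_eq_inv_mul]
    have s2 : infoGain u w (a / (2 * γ)) (b / (2 * γ)) = (2 * γ)⁻¹ * infoGain u w a b := by
      rw [← infoGain_smul hu hw, div_eq_inv_mul, div_eq_inv_mul]
    have p0 := infoGain_nonneg hu hw ha.le (ha.le.trans hab)
    have p1 := infoGain_le hu hw ha le_rfl hab
    have half : ∀ {M : ℝ}, 2 * b ≤ M → 1 / 2 ≤ 1 - a / M ∧ 1 / 2 ≤ 1 - b / M := by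
      intro M hM
      have hM0 : 0 < M := by linarith
      have h1 : b / M ≤ 1 / 2 := by rw [div_le_div_iff₀ hM0 two_pos]; linarith
      have h2 : a / M ≤ b / M := by gcongr
      constructor <;> linarith
    have rest : ∀ {M : ℝ}, 2 * b ≤ M → 0 ≤ infoGain u w (1 - a / M) (1 - b / M) ∧
        infoGain u w (1 - a / M) (1 - b / M) ≤ 2 * ((a - b) / M) ^ 2 * (u + w) := by
      intro M hM
      obtain ⟨h1, h2⟩ := half hM
      refine ⟨infoGain_nonneg hu hw (by linarith) (by linarith), ?_⟩
      refine (infoGain_le hu hw (by norm_num : (0 : ℝ) < 1 / 2) h1 h2).trans_eq ?_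
      ring
    obtain ⟨q0, q1⟩ := rest hN
    obtain ⟨r0, r1⟩ := rest (show 2 * b ≤ 2 * γ by linarith)
    have e4 : -(infoGain u w (a / N) (b / N) + infoGain u w (1 - a / N) (1 - b / N))
        - t * -(infoGain u w (a / (2 * γ)) (b / (2 * γ))
          + infoGain u w (1 - a / (2 * γ)) (1 - b / (2 * γ)))
        = -((N⁻¹ - t / (2 * γ)) * infoGain u w a b) - infoGain u w (1 - a / N) (1 - b / N)
          + t * infoGain u w (1 - a / (2 * γ)) (1 - b / (2 * γ)) := by
      rw [s1, s2]; ring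
    rw [e4]
    have m1 : |(N⁻¹ - t / (2 * γ)) * infoGain u w a b|
        ≤ |N⁻¹ - t / (2 * γ)| * ((a - b) ^ 2 / a * (u + w)) := by
      rw [abs_mul, abs_of_nonneg p0]; gcongr
    have m2 := mul_le_mul_of_nonneg_left r1 ht
    have m3 := mul_nonneg ht r0
    have m4 := abs_le.1 m1
    have m5 : 0 ≤ 2 * ((a - b) / N) ^ 2 * (u + w) := q0.trans q1
    have m6 := m3.trans m2
    have m7 : ε * (u + w) = |N⁻¹ - t / (2 * γ)| * ((a - b) ^ 2 / a * (u + w))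
        + 2 * ((a - b) / N) ^ 2 * (u + w) + t * (2 * ((a - b) / (2 * γ)) ^ 2 * (u + w)) := by
      rw [hε]; ring
    rw [m7, abs_le]
    constructor <;> linarith
  have h1 := hc.linear_le (f := f) fun v hv => (le_abs_self _).trans (key v hv)
  have h2 := hc.linear_le (f := -f) fun v hv => (neg_le_abs _).trans (key v hv)
  rw [abs_le]
  exact ⟨neg_le.1 h2, h1⟩

end Pair

/-! ### Reduction to at most one erased observation per pair -/

/-- The probability that a pair has at least one copy in the Poisson ensemble. -/
noncomputable def copyProb (γ : ℝ) (n : ℕ) : ℝ := 1 - Real.exp (-(γ * n / n.choose 2))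

lemma copyProb_nonneg {γ : ℝ} (hγ : 0 ≤ γ) (n : ℕ) : 0 ≤ copyProb γ n := by
  have : Real.exp (-(γ * n / n.choose 2)) ≤ 1 := Real.exp_le_one_iff.2 (neg_nonpos.2 (by positivity))
  unfold copyProb; linarith

lemma copyProb_le_one (γ : ℝ) (n : ℕ) : copyProb γ n ≤ 1 := by
  have := Real.exp_pos (-(γ * n / n.choose 2))
  unfold copyProb; linarith

lemma abs_copyProb_sub_le {γ : ℝ} (hγ : 0 ≤ γ) {n : ℕ} (hn : 1 ≤ n) :
    |copyProb γ n - 2 * γ / n| ≤ (4 * γ + 16 * γ ^ 2) / n ^ 2 := by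
  rcases hn.eq_or_lt with rfl | hn
  · simp only [copyProb, Nat.cast_one, Nat.choose_succ_self, Nat.cast_zero, div_zero, neg_zero,
      Real.exp_zero, sub_self, div_one, zero_sub, abs_neg, one_pow]
    rw [abs_of_nonneg (by positivity)]
    nlinarith [sq_nonneg γ]
  have hn2 : (2 : ℝ) ≤ n := by exact_mod_cast hn
  set r := γ * n / n.choose 2 with hr
  have hr2 : r = 2 * γ / (n - 1) := by
    have : (n : ℝ) - 1 ≠ 0 := by linarith
    rw [hr, Nat.cast_choose_two]; field_simp
  have hr0 : 0 ≤ r := by positivity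
  have up : copyProb γ n ≤ r := by
    have := Real.add_one_le_exp (-r)
    unfold copyProb; linarith
  have lo : r - r ^ 2 ≤ copyProb γ n := by
    have h1 : (1 + r) * Real.exp (-r) ≤ 1 := by
      have := Real.add_one_le_exp r
      calc (1 + r) * Real.exp (-r) ≤ Real.exp r * Real.exp (-r) := by gcongr; linarith
        _ = 1 := by rw [← Real.exp_add]; simp
    have h2 : Real.exp (-r) ≤ 1 - r + r ^ 2 := by
      have : (1 : ℝ) ≤ (1 + r) * (1 - r + r ^ 2) := by nlinarith [pow_nonneg hr0 3]
      exact le_of_mul_le_mul_left (h1.trans this) (by linarith)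
    unfold copyProb; linarith
  have hle : r ≤ 4 * γ / n := by
    rw [hr2, div_le_div_iff₀ (by linarith) (by linarith)]; nlinarith
  have hsub : r - 2 * γ / n ≤ 4 * γ / n ^ 2 := by
    have : r - 2 * γ / n = 2 * γ / ((n - 1) * n) := by
      have : (n : ℝ) - 1 ≠ 0 := by linarith
      rw [hr2]; field_simp; ring
    rw [this, div_le_div_iff₀ (by nlinarith) (by positivity)]
    nlinarith [mul_nonneg hγ (show (0 : ℝ) ≤ n by linarith)]
  have hge : 2 * γ / n ≤ r := by
    rw [hr2]; gcongr <;> linarith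
  have hsq : r ^ 2 ≤ 16 * γ ^ 2 / n ^ 2 := by
    calc r ^ 2 ≤ (4 * γ / n) ^ 2 := by gcongr
      _ = _ := by ring
  have h0 : 0 ≤ 4 * γ / (n : ℝ) ^ 2 := by positivity
  rw [add_div, abs_le]
  constructor <;> linarith [sq_nonneg r]

/-- The entropy of the sparse model in which each pair carries one observation with probability
`copyProb γ n` and none otherwise. -/
noncomputable def sparseEntropy (a b γ : ℝ) (n : ℕ) : ℝ :=
  entropy (∏ I : Edge 2 n, erasure (copyProb γ n) (pairChannel (a / (2 * γ)) (b / (2 * γ)) I.1))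

lemma card_edge (n : ℕ) : Fintype.card (Edge 2 n) = n.choose 2 := by
  rw [Fintype.card_finset_len, Fintype.card_fin]

lemma choose_two_le (n : ℕ) : (n.choose 2 : ℝ) ≤ n ^ 2 / 2 := by
  rw [Nat.cast_choose_two]
  have : (0 : ℝ) ≤ n := n.cast_nonneg
  nlinarith

lemma isChannel_pairChannel_div {a b M : ℝ} (ha : 0 < a) (hab : a ≤ b) (hM : b ≤ M)
    {V : Type*} (I : Finset V) : IsChannel (pairChannel (a / M) (b / M) I) := by
  have hM0 : 0 < M := by linarith
  exact isChannel_pairChannel (by positivity) ((div_le_one hM0).2 (by linarith))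
    (div_nonneg (by linarith) hM0.le) ((div_le_one hM0).2 hM) I

/-- The block model and the sparse erased model differ by `O(n / γ)`. -/
lemma abs_entropy_sbm_sub_sparse_le {a b γ : ℝ} (ha : 0 < a) (hab : a ≤ b) (hγ : b ≤ γ) :
    ∃ C, ∀ n : ℕ, 2 * b ≤ n →
      |entropy (∏ I : Edge 2 n, pairChannel (a / n) (b / n) I.1) - sparseEntropy a b γ n|
        ≤ (C + n * ((a - b) ^ 2 / (2 * γ))) * 2 ^ n := by
  have hγ0 : 0 < γ := by linarith
  set K := 4 * γ + 16 * γ ^ 2 with hK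
  refine ⟨1 / 2 * (K / (2 * γ) * ((a - b) ^ 2 / a) + 2 * (a - b) ^ 2
    + K * (2 * ((a - b) / (2 * γ)) ^ 2)), fun n hn => ?_⟩
  have hn0 : (0 : ℝ) < n := by linarith
  have hn1 : 1 ≤ n := by exact_mod_cast hn0
  set t := copyProb γ n with ht
  have ht0 : 0 ≤ t := copyProb_nonneg hγ0.le n
  have ht1 : t ≤ 1 := copyProb_le_one γ n
  have htK := abs_copyProb_sub_le hγ0.le hn1
  rw [← ht, ← hK] at htK
  set ε := |(n : ℝ)⁻¹ - t / (2 * γ)| * ((a - b) ^ 2 / a) + 2 * ((a - b) / n) ^ 2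
          + t * (2 * ((a - b) / (2 * γ)) ^ 2) with hε
  have hP := fun I : Edge 2 n => isChannel_pairChannel_div ha hab (by linarith : b ≤ (n : ℝ)) I.1
  have hQ := fun I : Edge 2 n => (isChannel_pairChannel_div ha hab
    (by linarith : b ≤ 2 * γ) I.1).erasure ht0 ht1
  have hd := fun (I : Edge 2 n) (c) (hc : IsChannel c) => abs_le.1
    (abs_entropy_mul_sub_le ha hab hn hγ ht0 I.1 hc)
  have h1 := entropy_mul_prod_le Finset.univ (ε := fun _ => ε) (fun I _ => hP I) (fun I _ => hQ I)
    (fun I _ c hc => by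
      have := (hd I c hc).2
      rw [mul_sub, map_sub] at this
      linarith) IsChannel.one
  have h2 := entropy_mul_prod_le Finset.univ (ε := fun _ => ε) (fun I _ => hQ I) (fun I _ => hP I)
    (fun I _ c hc => by
      have := (hd I c hc).1
      rw [mul_sub, map_sub] at this
      linarith) IsChannel.one
  simp only [one_mul, Finset.sum_const, Finset.card_univ, card_edge, nsmul_eq_mul,
    Fintype.card_pi, Fintype.card_fin, Finset.prod_const, Nat.cast_pow, Nat.cast_ofNat] at h1 h2
  have hε0 : 0 ≤ ε := by positivity
  have hmain : n.choose 2 * ε ≤ 1 / 2 * (K / (2 * γ) * ((a - b) ^ 2 / a) + 2 * (a - b) ^ 2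
      + K * (2 * ((a - b) / (2 * γ)) ^ 2)) + n * ((a - b) ^ 2 / (2 * γ)) := by
    have b1 : |(n : ℝ)⁻¹ - t / (2 * γ)| ≤ K / n ^ 2 / (2 * γ) := by
      have : (n : ℝ)⁻¹ - t / (2 * γ) = -((t - 2 * γ / n) / (2 * γ)) := by field_simp; ring
      rw [this, abs_neg, abs_div, abs_of_pos (by positivity : 0 < 2 * γ)]
      gcongr
    have b2 : t ≤ 2 * γ / n + K / n ^ 2 := by linarith [(abs_le.1 htK).2]
    have b3 : ε ≤ K / n ^ 2 / (2 * γ) * ((a - b) ^ 2 / a) + 2 * ((a - b) / n) ^ 2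
        + (2 * γ / n + K / n ^ 2) * (2 * ((a - b) / (2 * γ)) ^ 2) := by
      rw [hε]; gcongr
    calc n.choose 2 * ε ≤ n ^ 2 / 2 * (K / n ^ 2 / (2 * γ) * ((a - b) ^ 2 / a)
          + 2 * ((a - b) / n) ^ 2 + (2 * γ / n + K / n ^ 2) * (2 * ((a - b) / (2 * γ)) ^ 2)) :=
        mul_le_mul (choose_two_le n) b3 hε0 (by positivity)
      _ = _ := by field_simp; ring
  have hmain2 := mul_le_mul_of_nonneg_right hmain (by positivity : (0 : ℝ) ≤ 2 ^ n)
  unfold sparseEntropy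
  rw [abs_le]
  constructor <;> linarith

lemma pairChannel_pow {V : Type*} (α β : ℝ) (I : Finset V) (k : ℕ) :
    pairChannel α β I ^ k = statChannel (Agree I) (fun z : Fin k → Fin 2 => ∏ i, bern α (z i))
      (fun z => ∏ i, bern β (z i)) := by
  have := formal_prod fun (_ : Fin k) x z => if Agree I x then bern α z else bern β z
  rw [Finset.prod_const, Finset.card_univ, Fintype.card_fin, formal_eq_statChannel] at this
  rw [pairChannel, ← this, ← formal_eq_statChannel]
  congr 1
  ext x z
  split_ifs <;> rfl

lemma sum_prod_bern (α : ℝ) (k : ℕ) : ∑ z : Fin k → Fin 2, ∏ i, bern α (z i) = 1 := by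
  have := Finset.prod_univ_sum (fun _ : Fin k => (Finset.univ : Finset (Fin 2)))
    fun _ z => bern α z
  rw [Fintype.piFinset_univ] at this
  rw [← this]
  simp only [sum_bern, Finset.prod_const_one]

section

variable {V : Type*} [Fintype V] [DecidableEq V]

/-- The copies of an observed pair beyond the first one carry at most one bit in total. -/
lemma entropy_mul_pairChannel_pow {α β : ℝ} (hα : 0 ≤ α) (hα1 : α ≤ 1) (hβ : 0 ≤ β) (hβ1 : β ≤ 1)
    (I : Finset V) (k : ℕ) {c : FormalChannel (V → Fin 2)} (hc : IsChannel c) :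
    entropy (c * pairChannel α β I ^ k) ≤ entropy (c * pairChannel α β I ^ min k 1) ∧
      entropy (c * pairChannel α β I ^ min k 1) ≤ entropy (c * pairChannel α β I ^ k)
        + (if 2 ≤ k then Real.log 2 else 0) * Fintype.card (V → Fin 2) := by
  by_cases hk : 2 ≤ k
  · rw [if_pos hk, min_eq_right (by omega : 1 ≤ k), pow_one]
    obtain ⟨l, rfl⟩ : ∃ l, k = l + 1 := ⟨k - 1, by omega⟩
    have := entropy_mul_statChannel_sub_one (Agree I)
      (α := fun z : Fin l → Fin 2 => ∏ i, bern α (z i)) (β := fun z => ∏ i, bern β (z i))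
      (fun z => Finset.prod_nonneg fun i _ => bern_nonneg hα hα1 _)
      (fun z => Finset.prod_nonneg fun i _ => bern_nonneg hβ hβ1 _)
      (sum_prod_bern α l) (sum_prod_bern β l)
      (hc.mul (isChannel_pairChannel hα hα1 hβ hβ1 I))
    rw [← pairChannel_pow, mul_sub, mul_one, map_sub, mul_assoc, ← pow_succ'] at this
    constructor <;> linarith [this.1, this.2]
  · rw [min_eq_left (by omega : k ≤ 1), if_neg hk]
    simp

end

lemma integral_poisson_eq_zero (r : NNReal) :
    ∫ k, (if k = 0 then (1 : ℝ) else 0) ∂(ProbabilityTheory.poissonMeasure r) = Real.exp (-r) := by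
  have : (fun k : ℕ => if k = 0 then (1 : ℝ) else 0) = Set.indicator {0} 1 := by
    ext k; simp [Set.indicator]
  rw [this, integral_indicator_one (measurableSet_singleton 0),
    ProbabilityTheory.poissonMeasure_real_singleton]
  simp

lemma integral_poisson_ne_zero (r : NNReal) :
    ∫ k, (if k = 0 then (0 : ℝ) else 1) ∂(ProbabilityTheory.poissonMeasure r)
      = 1 - Real.exp (-r) := by
  have : (fun k : ℕ => if k = 0 then (0 : ℝ) else 1) = fun k => 1 - if k = 0 then (1 : ℝ) else 0 := by
    ext k; split_ifs <;> simp
  rw [this, integral_sub (integrable_const _), integral_poisson_eq_zero]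
  · simp
  · exact Integrable.of_bound (measurable_of_countable _).aestronglyMeasurable 1
      (ae_of_all _ fun k => by split_ifs <;> simp)

lemma integral_poisson_two_le (r : NNReal) :
    ∫ k, (if 2 ≤ k then (1 : ℝ) else 0) ∂(ProbabilityTheory.poissonMeasure r) ≤ r ^ 2 := by
  have h1 : (fun k : ℕ => if 2 ≤ k then (1 : ℝ) else 0)
      = fun k => (if k = 0 then (0 : ℝ) else 1) - Set.indicator {1} 1 k := by
    ext k
    rcases k with _ | _ | k <;> simp
  have hb : ∀ {f : ℕ → ℝ}, (∀ k, ‖f k‖ ≤ 1) →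
      Integrable f (ProbabilityTheory.poissonMeasure r) := fun h =>
    Integrable.of_bound (measurable_of_countable _).aestronglyMeasurable 1 (ae_of_all _ h)
  rw [h1, integral_sub (hb fun k => by split_ifs <;> simp)
    (hb fun k => by by_cases h : k = 1 <;> simp [h]), integral_poisson_ne_zero,
    integral_indicator_one (measurableSet_singleton 1),
    ProbabilityTheory.poissonMeasure_real_singleton]
  have h2 := Real.add_one_le_exp (-(r : ℝ))
  have h3 : (0 : ℝ) ≤ r := r.2
  simp only [pow_one, Nat.factorial_one, Nat.cast_one, div_one]
  nlinarith

lemma integrable_poissonEnsemble {k n : ℕ} (γ : ℝ) {f : (Edge k n → ℕ) → ℝ} {C : ℝ}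
    (h : ∀ m, ‖f m‖ ≤ C) : Integrable f (poissonEnsemble k γ n) := by
  have : IsFiniteMeasure (poissonEnsemble k γ n) := by unfold poissonEnsemble; infer_instance
  exact Integrable.of_bound (measurable_of_countable _).aestronglyMeasurable C (ae_of_all _ h)

/-- Truncating the multiplicities at `1` turns a Poisson number of copies into an erasure. -/
lemma integral_entropy_pow_min {A : Type*} [Fintype A] {n : ℕ} {γ : ℝ} (hγ : 0 ≤ γ)
    (Q : Edge 2 n → FormalChannel A) :
    ∫ m, entropy (∏ I, Q I ^ min (m I) 1) ∂(poissonEnsemble 2 γ n)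
      = entropy (∏ I, erasure (copyProb γ n) (Q I)) := by
  have expand : ∀ p q : Edge 2 n → ℝ, entropy (∏ I, (q I • Q I + p I • 1))
      = ∑ S : Finset (Edge 2 n), (∏ I, if I ∈ S then q I else p I) * entropy (∏ I ∈ S, Q I) := by
    intro p q
    rw [Fintype.prod_add, map_sum]
    refine Finset.sum_congr rfl fun S _ => ?_
    rw [Finset.prod_smul, Finset.prod_smul, Finset.prod_const_one, smul_mul_smul_comm, mul_one,
      map_smul, smul_eq_mul, Finset.prod_ite]
    congr 3
    · ext I; simp
    · ext I; simp
  have e1 : ∀ m : Edge 2 n → ℕ, ∏ I, Q I ^ min (m I) 1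
      = ∏ I, ((if m I = 0 then (0 : ℝ) else 1) • Q I + (if m I = 0 then (1 : ℝ) else 0) • 1) := by
    intro m
    refine Finset.prod_congr rfl fun I _ => ?_
    by_cases h : m I = 0
    · simp [h]
    · rw [min_eq_right (by omega)]; simp [h]
  have e2 : ∀ I, erasure (copyProb γ n) (Q I) = copyProb γ n • Q I + (1 - copyProb γ n) • 1 := by
    intro I
    rw [erasure, smul_sub, sub_smul, one_smul]; abel
  have hr : ((γ * n / n.choose 2).toNNReal : ℝ) = γ * n / n.choose 2 :=
    Real.coe_toNNReal _ (by positivity)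
  simp only [e1, e2, expand]
  rw [integral_finsetSum]
  · refine Finset.sum_congr rfl fun S _ => ?_
    rw [integral_mul_const]
    congr 1
    rw [poissonEnsemble, integral_fintype_prod_eq_prod
      (fun (I : Edge 2 n) (k : ℕ) => if I ∈ S then (if k = 0 then (0 : ℝ) else 1)
        else (if k = 0 then (1 : ℝ) else 0))]
    refine Finset.prod_congr rfl fun I _ => ?_
    split_ifs
    · rw [integral_poisson_ne_zero, hr, copyProb]
    · rw [integral_poisson_eq_zero, hr, copyProb, sub_sub_cancel]
  · intro S _
    refine (integrable_poissonEnsemble (C := 1) γ fun m => ?_).mul_const _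
    rw [norm_prod]
    exact Finset.prod_le_one (fun _ _ => norm_nonneg _) fun I _ => by split_ifs <;> simp

/-- The mean number of pairs with repeated copies is bounded, and so is their contribution. -/
lemma abs_integral_entropy_sub_sparse_le {a b γ : ℝ} (ha : 0 < a) (hab : a ≤ b) (hγ : b ≤ γ)
    {n : ℕ} (hn : 2 ≤ n) :
    |∫ m, entropy (∏ I : Edge 2 n, pairChannel (a / (2 * γ)) (b / (2 * γ)) I.1 ^ m I)
        ∂(poissonEnsemble 2 γ n) - sparseEntropy a b γ n|
      ≤ 4 * γ ^ 2 * Real.log 2 * 2 ^ n := by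
  have hγ0 : 0 < γ := by linarith
  set Q := fun I : Edge 2 n => pairChannel (a / (2 * γ)) (b / (2 * γ)) I.1 with hQ
  have hg : 0 < 2 * γ := by linarith
  have q0 : 0 ≤ a / (2 * γ) := by positivity
  have q1 : a / (2 * γ) ≤ 1 := (div_le_one hg).2 (by linarith)
  have q2 : 0 ≤ b / (2 * γ) := div_nonneg (by linarith) hg.le
  have q3 : b / (2 * γ) ≤ 1 := (div_le_one hg).2 (by linarith)
  have hQc : ∀ I, IsChannel (Q I) := fun I => isChannel_pairChannel q0 q1 q2 q3 I.1
  set F := fun m : Edge 2 n → ℕ => entropy (∏ I, Q I ^ m I) with hF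
  set G := fun m : Edge 2 n → ℕ => entropy (∏ I, Q I ^ min (m I) 1) with hG
  set R := fun m : Edge 2 n → ℕ => ∑ I, (if 2 ≤ m I then (1 : ℝ) else 0) with hR
  have hFG : ∀ m, F m ≤ G m := by
    intro m
    have := entropy_mul_prod_le Finset.univ (ε := fun _ => 0)
      (fun I _ => (hQc I).pow (m I)) (fun I _ => (hQc I).pow (min (m I) 1))
      (fun I _ c hc => by
        simpa using (entropy_mul_pairChannel_pow q0 q1 q2 q3 I.1 (m I) hc).1) IsChannel.one
    simpa using this
  have hGF : ∀ m, G m ≤ F m + R m * (Real.log 2 * 2 ^ n) := by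
    intro m
    have := entropy_mul_prod_le Finset.univ (ε := fun I => if 2 ≤ m I then Real.log 2 else 0)
      (fun I _ => (hQc I).pow (min (m I) 1)) (fun I _ => (hQc I).pow (m I))
      (fun I _ c hc => (entropy_mul_pairChannel_pow q0 q1 q2 q3 I.1 (m I) hc).2) IsChannel.one
    have e : ∑ I, (if 2 ≤ m I then Real.log 2 else 0) = R m * Real.log 2 := by
      rw [hR, Finset.sum_mul]
      exact Finset.sum_congr rfl fun I _ => by split_ifs <;> simp
    rw [e] at this
    simpa [mul_assoc] using this
  -- truncated multiplicities take finitely many values, so that `G` is bounded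
  have hGb : ∃ C, ∀ m, ‖G m‖ ≤ C := by
    refine ⟨∑ S : Finset (Edge 2 n), ‖entropy (∏ I ∈ S, Q I)‖, fun m => ?_⟩
    have e : G m = entropy (∏ I ∈ Finset.univ.filter fun I => 1 ≤ m I, Q I) := by
      simp only [hG]
      rw [Finset.prod_filter]
      congr 1
      refine Finset.prod_congr rfl fun I _ => ?_
      split_ifs with h
      · rw [min_eq_right h, pow_one]
      · rw [min_eq_left (by omega), (by omega : m I = 0), pow_zero]
    rw [e]
    exact Finset.single_le_sum (f := fun S : Finset (Edge 2 n) => ‖entropy (∏ I ∈ S, Q I)‖)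
      (fun S _ => norm_nonneg _) (Finset.mem_univ _)
  obtain ⟨C, hC⟩ := hGb
  have hR0 : ∀ m, 0 ≤ R m := fun m => Finset.sum_nonneg fun I _ => by split_ifs <;> simp
  have hRb : ∀ m, R m ≤ n.choose 2 := by
    intro m
    calc R m ≤ ∑ I : Edge 2 n, (1 : ℝ) := Finset.sum_le_sum fun I _ => by split_ifs <;> simp
      _ = n.choose 2 := by simp
  have hp : (0 : ℝ) ≤ Real.log 2 * 2 ^ n := mul_nonneg (Real.log_nonneg one_le_two) (by positivity)
  have iG : Integrable G (poissonEnsemble 2 γ n) := integrable_poissonEnsemble γ hC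
  have iR : Integrable R (poissonEnsemble 2 γ n) := integrable_poissonEnsemble γ (C := n.choose 2)
    fun m => by rw [Real.norm_eq_abs, abs_of_nonneg (hR0 m)]; exact hRb m
  have iF : Integrable F (poissonEnsemble 2 γ n) :=
    integrable_poissonEnsemble γ (C := C + n.choose 2 * (Real.log 2 * 2 ^ n)) fun m => by
      have h1 := abs_le.1 (hC m)
      have h2 := hFG m
      have h3 := hGF m
      have h4 := mul_le_mul_of_nonneg_right (hRb m) hp
      have h5 := mul_nonneg (Nat.cast_nonneg (α := ℝ) (n.choose 2)) hp
      rw [Real.norm_eq_abs, abs_le]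
      constructor <;> linarith
  have hGi : ∫ m, G m ∂(poissonEnsemble 2 γ n) = sparseEntropy a b γ n :=
    integral_entropy_pow_min hγ0.le Q
  have hRi : ∫ m, R m ∂(poissonEnsemble 2 γ n) ≤ 4 * γ ^ 2 := by
    have hn2 : (2 : ℝ) ≤ n := by exact_mod_cast hn
    have hr : ((γ * n / n.choose 2).toNNReal : ℝ) = γ * n / n.choose 2 :=
      Real.coe_toNNReal _ (by positivity)
    simp only [hR]
    rw [integral_finsetSum]
    · have : ∀ I : Edge 2 n, ∫ m, (if 2 ≤ m I then (1 : ℝ) else 0) ∂(poissonEnsemble 2 γ n)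
          ≤ (γ * n / n.choose 2) ^ 2 := by
        intro I
        have := integral_comp_eval (X := fun _ : Edge 2 n => ℕ) (i := I)
          (μ := fun _ => ProbabilityTheory.poissonMeasure (γ * n / n.choose 2).toNNReal)
          (f := fun k : ℕ => if 2 ≤ k then (1 : ℝ) else 0)
          (measurable_of_countable _).aestronglyMeasurable
        rw [poissonEnsemble, this]
        exact (integral_poisson_two_le _).trans_eq (by rw [hr])
      refine (Finset.sum_le_sum fun I _ => this I).trans ?_
      rw [Finset.sum_const, Finset.card_univ, card_edge, nsmul_eq_mul, Nat.cast_choose_two]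
      have h1 : (0 : ℝ) < n - 1 := by linarith
      have : (n : ℝ) * (n - 1) / 2 * (γ * n / (n * (n - 1) / 2)) ^ 2
          = 2 * γ ^ 2 * n / (n - 1) := by
        field_simp
      rw [this, div_le_iff₀ h1]
      nlinarith [sq_nonneg γ]
    · intro I _
      exact integrable_poissonEnsemble γ (C := 1) fun m => by split_ifs <;> simp
  have u1 : ∫ m, F m ∂(poissonEnsemble 2 γ n) ≤ ∫ m, G m ∂(poissonEnsemble 2 γ n) :=
    integral_mono iF iG hFG
  have u2 : ∫ m, G m ∂(poissonEnsemble 2 γ n) ≤ ∫ m, F m ∂(poissonEnsemble 2 γ n)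
      + (∫ m, R m ∂(poissonEnsemble 2 γ n)) * (Real.log 2 * 2 ^ n) := by
    rw [← integral_mul_const, ← integral_add iF (iR.mul_const _)]
    exact integral_mono iG (iF.add (iR.mul_const _)) hGF
  have u3 := mul_le_mul_of_nonneg_right hRi hp
  have u4 : 0 ≤ 4 * γ ^ 2 * (Real.log 2 * 2 ^ n) := mul_nonneg (by positivity) hp
  rw [hGi] at u1 u2
  rw [abs_le]
  constructor <;> linarith

/-! ### Interpolation between erasure rates -/

section Interpolation

variable {A : Type*} [Fintype A] {ι : Type*} [DecidableEq ι]

lemma hasDerivAt_entropy_mul_prod (s : Finset ι) (X Y : ι → FormalChannel A)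
    (c : FormalChannel A) (t : ℝ) :
    HasDerivAt (fun t : ℝ => entropy (c * ∏ i ∈ s, (X i + t • Y i)))
      (∑ i ∈ s, entropy (c * (Y i * ∏ j ∈ s.erase i, (X j + t • Y j)))) t := by
  induction s using Finset.induction_on generalizing c with
  | empty => simpa using hasDerivAt_const t _
  | insert k s hk ih =>
    have e : (fun t : ℝ => entropy (c * ∏ i ∈ insert k s, (X i + t • Y i)))
        = fun t => entropy (c * X k * ∏ i ∈ s, (X i + t • Y i))
          + t * entropy (c * Y k * ∏ i ∈ s, (X i + t • Y i)) := by
      ext t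
      rw [Finset.prod_insert hk, ← smul_eq_mul t, ← map_smul, ← map_add]
      congr 1
      rw [← mul_assoc, mul_add, add_mul, mul_smul_comm, smul_mul_assoc]
    rw [e]
    refine ((ih (c * X k)).add ((hasDerivAt_id t).mul (ih (c * Y k)))).congr_deriv ?_
    rw [Finset.sum_insert hk, Finset.erase_insert hk, id_eq, one_mul, add_left_comm,
      Finset.mul_sum, ← Finset.sum_add_distrib, mul_assoc]
    congr 1
    refine Finset.sum_congr rfl fun i hi => ?_
    have hik : k ≠ i := fun h => hk (h ▸ hi)
    rw [Finset.erase_insert_of_ne hik, Finset.prod_insert (fun h => hk (Finset.mem_of_mem_erase h)),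
      ← smul_eq_mul t, ← map_smul, ← map_add]
    congr 1
    rw [Algebra.smul_def, Algebra.smul_def]
    ring

/-- If at every channel `c` the observations `K i`, weighted by the changes `q i - p i` of their
rates, decrease the entropy up to `C`, then so does the change of the rates from `p` to `q`, up to a
correction quadratic in the rates.  The correction arises since the derivative in the `i`-th rate
involves the product channel without its `i`-th factor. -/
lemma entropy_prod_erasure_le (s : Finset ι) {K : ι → FormalChannel A} {p q : ι → ℝ} {C L : ℝ}
    (hK : ∀ i ∈ s, IsChannel (K i))
    (hL : ∀ i ∈ s, ∀ c, IsChannel c → entropy (c * (K i - 1)) ≤ 0 ∧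
      -(L * Fintype.card A) ≤ entropy (c * (K i - 1)))
    (p0 : ∀ i, 0 ≤ p i) (p1 : ∀ i, p i ≤ 1) (q0 : ∀ i, 0 ≤ q i) (q1 : ∀ i, q i ≤ 1)
    (h : ∀ c, IsChannel c → ∑ i ∈ s, (q i - p i) * entropy (c * (K i - 1)) ≤ C * Fintype.card A) :
    entropy (∏ i ∈ s, erasure (q i) (K i)) ≤ entropy (∏ i ∈ s, erasure (p i) (K i))
      + (C + L * ∑ i ∈ s, (p i ^ 2 + q i ^ 2)) * Fintype.card A := by
  set f := fun t : ℝ => entropy ((1 : FormalChannel A) *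
    ∏ i ∈ s, (erasure (p i) (K i) + t • ((q i - p i) • (K i - 1)))) with hf
  have hd := hasDerivAt_entropy_mul_prod s (fun i => erasure (p i) (K i))
    (fun i => (q i - p i) • (K i - 1)) 1
  have heq : ∀ t i, erasure (p i) (K i) + t • ((q i - p i) • (K i - 1))
      = erasure (p i + t * (q i - p i)) (K i) := by
    intro t i
    simp only [erasure, smul_smul, add_smul, add_assoc]
  have bound : ∀ t ∈ interior (Set.Icc (0 : ℝ) 1), deriv f t
      ≤ (C + L * ∑ i ∈ s, (p i ^ 2 + q i ^ 2)) * Fintype.card A := by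
    intro t ht
    rw [interior_Icc] at ht
    rw [(hd t).deriv]
    simp only [one_mul, heq, smul_mul_assoc, map_smul, smul_eq_mul]
    set r := fun i => p i + t * (q i - p i) with hr
    have r0 : ∀ i, 0 ≤ r i := fun i => by
      have := p0 i; have := q0 i; simp only [hr]; nlinarith [ht.1, ht.2]
    have r1 : ∀ i, r i ≤ 1 := fun i => by
      have := p1 i; have := q1 i; simp only [hr]; nlinarith [ht.1, ht.2]
    have hch : ∀ i ∈ s, IsChannel (erasure (r i) (K i)) := fun i hi =>
      (hK i hi).erasure (r0 i) (r1 i)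
    have hP := h _ (IsChannel.prod s hch)
    have hterm : ∀ i ∈ s, (q i - p i) * entropy ((K i - 1) * ∏ j ∈ s.erase i, erasure (r j) (K j))
        ≤ (q i - p i) * entropy ((∏ j ∈ s, erasure (r j) (K j)) * (K i - 1))
          + (p i ^ 2 + q i ^ 2) * (L * Fintype.card A) := by
      intro i hi
      set R := ∏ j ∈ s.erase i, erasure (r j) (K j) with hR
      have hRc : IsChannel R := IsChannel.prod _ fun j hj => hch j (Finset.mem_of_mem_erase hj)
      have e : (∏ j ∈ s, erasure (r j) (K j)) * (K i - 1)
          = (K i - 1) * R + r i • (R * K i * (K i - 1) - R * (K i - 1)) := by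
        rw [← Finset.mul_prod_erase s _ hi, ← hR, erasure, Algebra.smul_def, Algebra.smul_def]
        ring
      rw [e, map_add, map_smul, map_sub, smul_eq_mul]
      obtain ⟨x1, x2⟩ := hL i hi _ (hRc.mul (hK i hi))
      obtain ⟨y1, y2⟩ := hL i hi _ hRc
      set x := entropy (R * K i * (K i - 1)) - entropy (R * (K i - 1)) with hx
      have hxa : |x| ≤ L * Fintype.card A := by rw [abs_le]; constructor <;> linarith
      have hmu : |(q i - p i) * r i| ≤ p i ^ 2 + q i ^ 2 := by
        have := p0 i; have := q0 i
        have hqp : |q i - p i| ≤ max (p i) (q i) := by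
          rw [abs_le]
          constructor <;> linarith [le_max_left (p i) (q i), le_max_right (p i) (q i)]
        have hri : r i ≤ max (p i) (q i) := by
          have h1 := le_max_left (p i) (q i)
          have h2 := le_max_right (p i) (q i)
          simp only [hr]
          nlinarith [ht.1, ht.2]
        rw [abs_mul, abs_of_nonneg (r0 i)]
        calc |q i - p i| * r i ≤ max (p i) (q i) * max (p i) (q i) := by
              gcongr
              exact r0 i
          _ ≤ p i ^ 2 + q i ^ 2 := by
              rcases max_choice (p i) (q i) with h | h <;> rw [h] <;> nlinarith
      have := mul_le_mul hmu hxa (abs_nonneg _) (by positivity)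
      rw [← abs_mul] at this
      have := (abs_le.1 this).1
      nlinarith
    refine (Finset.sum_le_sum hterm).trans ?_
    rw [Finset.sum_add_distrib, ← Finset.sum_mul]
    linarith
  have mv := (convex_Icc (0 : ℝ) 1).image_sub_le_mul_sub_of_deriv_le (f := f)
    (fun t _ => (hd t).continuousAt.continuousWithinAt)
    (fun t _ => (hd t).differentiableAt.differentiableWithinAt) bound 0 (by simp) 1 (by simp)
    zero_le_one
  have f0 : f 0 = entropy (∏ i ∈ s, erasure (p i) (K i)) := by simp [hf]
  have f1 : f 1 = entropy (∏ i ∈ s, erasure (q i) (K i)) := by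
    simp only [hf, heq, one_mul, add_sub_cancel]
  rw [f0, f1] at mv
  linarith

end Interpolation

/-! ### Positive definiteness of the information about a pair -/

lemma hasSum_one_sub_mul_log {x : ℝ} (hx : |x| < 1) :
    HasSum (fun l : ℕ => x ^ (l + 2) / ((l + 1) * (l + 2))) ((1 - x) * Real.log (1 - x) + x) := by
  have h1 := Real.hasSum_pow_div_log_of_abs_lt_one hx
  have h2 := (hasSum_nat_add_iff' 1).2 h1
  have h3 := (h1.mul_left x).sub h2
  have e1 : (fun l : ℕ => x ^ (l + 2) / ((l + 1) * (l + 2)))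
      = fun l : ℕ => x * (x ^ (l + 1) / (l + 1)) - x ^ (l + 1 + 1) / ((l + 1 : ℕ) + 1) := by
    ext l
    have : (l : ℝ) + 1 ≠ 0 := by positivity
    have : (l : ℝ) + 2 ≠ 0 := by positivity
    have : (l : ℝ) + 1 + 1 ≠ 0 := by positivity
    push_cast
    field_simp
    ring
  have e2 : (1 - x) * Real.log (1 - x) + x = x * -Real.log (1 - x)
      - (-Real.log (1 - x) - ∑ i ∈ Finset.range 1, x ^ (i + 1) / (i + 1)) := by
    simp only [Finset.sum_range_one, Nat.cast_zero, zero_add, pow_one, div_one]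
    ring
  rw [e1, e2]
  exact h3

/-- The output entropy, as a function of the correlation `m` of the pair, is minus a power series
whose coefficients from the second order on are nonnegative.  It is here that `α ≤ β` and
`α + β ≤ 1` matter. -/
lemma exists_hasSum_negMulLog {α β : ℝ} (hα : 0 < α) (hαβ : α ≤ β) (hs : α + β ≤ 1) :
    ∃ (k₀ k₁ : ℝ) (g : ℕ → ℝ), (∀ l, 0 ≤ g l) ∧ ∀ m : ℝ, |m| ≤ 1 →
      HasSum (fun l => g l * m ^ (l + 2))
        (-(negMulLog ((α + β) / 2 - (β - α) / 2 * m)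
          + negMulLog (1 - ((α + β) / 2 - (β - α) / 2 * m))) - k₀ - k₁ * m) := by
  set s := (α + β) / 2 with hs'
  set d := (β - α) / 2 with hd'
  set r := 1 - s with hr'
  have hs0 : 0 < s := by rw [hs']; linarith
  have hd0 : 0 ≤ d := by rw [hd']; linarith
  have hds : d < s := by rw [hs', hd']; linarith
  have hsr : s ≤ r := by rw [hr', hs']; linarith
  have hr0 : 0 < r := hs0.trans_le hsr
  refine ⟨s * Real.log s + r * Real.log r, d * (Real.log r - Real.log s),
    fun l => (s * (d / s) ^ (l + 2) + r * (-(d / r)) ^ (l + 2)) / ((l + 1) * (l + 2)), ?_, ?_⟩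
  · intro l
    refine div_nonneg ?_ (by positivity)
    have h1 : |r * (-(d / r)) ^ (l + 2)| ≤ s * (d / s) ^ (l + 2) := by
      rw [abs_mul, abs_pow, abs_neg, abs_of_pos hr0, abs_of_nonneg (by positivity)]
      have e : ∀ {y : ℝ}, 0 < y → y * (d / y) ^ (l + 2) = d * (d / y) ^ (l + 1) := by
        intro y hy
        rw [pow_succ']; field_simp
      rw [e hr0, e hs0]
      gcongr
    linarith [neg_abs_le (r * (-(d / r)) ^ (l + 2))]
  · intro m hm
    have hx : |d / s * m| < 1 := by
      rw [abs_mul, abs_of_nonneg (by positivity)]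
      have : d / s < 1 := (div_lt_one hs0).2 hds
      have : 0 ≤ d / s := by positivity
      nlinarith [abs_nonneg m]
    have hy : |-(d / r) * m| < 1 := by
      rw [abs_mul, abs_neg, abs_of_nonneg (by positivity)]
      have : d / r < 1 := (div_lt_one hr0).2 (hds.trans_le hsr)
      have : 0 ≤ d / r := by positivity
      nlinarith [abs_nonneg m]
    have h := ((hasSum_one_sub_mul_log hx).mul_left s).add ((hasSum_one_sub_mul_log hy).mul_left r)
    have e0 : (fun l : ℕ => (s * (d / s) ^ (l + 2) + r * (-(d / r)) ^ (l + 2))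
        / ((l + 1) * (l + 2)) * m ^ (l + 2))
        = fun l : ℕ => s * ((d / s * m) ^ (l + 2) / ((l + 1) * (l + 2)))
          + r * ((-(d / r) * m) ^ (l + 2) / ((l + 1) * (l + 2))) := by
      ext l
      rw [mul_pow, mul_pow]
      ring
    have e1 : s - d * m = s * (1 - d / s * m) := by field_simp
    have e2 : 1 - (s - d * m) = r * (1 - -(d / r) * m) := by
      have : r * (1 - -(d / r) * m) = r + d * m := by field_simp; ring
      rw [this, hr']; ring
    have p1 : 1 - d / s * m ≠ 0 := by linarith [(abs_lt.1 hx).2]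
    have p2 : 1 - -(d / r) * m ≠ 0 := by linarith [(abs_lt.1 hy).2]
    have e3 : -(negMulLog (s - d * m) + negMulLog (1 - (s - d * m)))
        - (s * Real.log s + r * Real.log r) - d * (Real.log r - Real.log s) * m
        = s * ((1 - d / s * m) * Real.log (1 - d / s * m) + d / s * m)
          + r * ((1 - -(d / r) * m) * Real.log (1 - -(d / r) * m) + -(d / r) * m) := by
      rw [e2, e1, negMulLog, negMulLog, Real.log_mul hs0.ne' p1, Real.log_mul hr0.ne' p2]
      have f1 : s * (d / s * m) = d * m := by field_simp
      have f2 : r * (-(d / r) * m) = -(d * m) := by field_simp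
      linear_combination (-Real.log s - 1) * f1 + (-Real.log r - 1) * f2
    rw [e0, e3]
    exact h

/-- The information gained about a pair of weights `u`, `w` is affine in the correlation up to
`-D`, where `D` preserves positive semidefiniteness on vectors of sum zero. -/
lemma exists_infoGain_eq {α β : ℝ} (hα : 0 < α) (hαβ : α ≤ β) (hs : α + β ≤ 1) :
    ∃ (κ B : ℝ) (D : ℝ → ℝ), (∀ m, |m| ≤ 1 → |D m| ≤ B) ∧
      (∀ u w : ℝ, 0 ≤ u → 0 ≤ w → infoGain u w α β + infoGain u w (1 - α) (1 - β)
        = -((u + w) * D ((u - w) / (u + w)) + κ * (u - w))) ∧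
      ∀ (V : Type) [Fintype V] (z : V → ℝ) (M : V → V → ℝ), ∑ i, z i = 0 →
        (∀ i j, |M i j| ≤ 1) → (∀ l : ℕ, 0 ≤ ∑ i, ∑ j, z i * z j * M i j ^ l) →
        0 ≤ ∑ i, ∑ j, z i * z j * D (M i j) := by
  obtain ⟨k₀, k₁, g, hg, hsum⟩ := exists_hasSum_negMulLog hα hαβ hs
  set hA := negMulLog α + negMulLog (1 - α) with hhA
  set hB := negMulLog β + negMulLog (1 - β) with hhB
  set D := fun m : ℝ => k₀ + (hA + hB) / 2 + ∑' l, g l * m ^ (l + 2) with hD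
  refine ⟨k₁ + (hA - hB) / 2, |k₀ + (hA + hB) / 2| + ∑' l, g l, D, ?_, ?_, ?_⟩
  · intro m hm
    have s1 : Summable g := by simpa using (hsum 1 (by simp)).summable
    have h1 : ∀ l, ‖g l * m ^ (l + 2)‖ ≤ g l := fun l => by
      rw [norm_mul, norm_pow, Real.norm_eq_abs, Real.norm_eq_abs, abs_of_nonneg (hg l)]
      exact mul_le_of_le_one_right (hg l) (pow_le_one₀ (abs_nonneg m) hm)
    refine (abs_add_le _ _).trans (add_le_add le_rfl ?_)
    exact tsum_of_norm_bounded s1.hasSum h1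
  · intro u w hu hw
    rcases (add_nonneg hu hw).eq_or_lt with h | h
    · obtain rfl : u = 0 := by linarith
      obtain rfl : w = 0 := by linarith
      simp [infoGain]
    set m := (u - w) / (u + w) with hm
    have hm1 : |m| ≤ 1 := by
      rw [hm, abs_div, abs_of_pos h, div_le_one h, abs_le]; constructor <;> linarith
    have e1 : (u * α + w * β) / (u + w) = (α + β) / 2 - (β - α) / 2 * m := by
      rw [hm]; field_simp; ring
    have e2 : (u * (1 - α) + w * (1 - β)) / (u + w) = 1 - ((α + β) / 2 - (β - α) / 2 * m) := by
      rw [hm]; field_simp; ring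
    have e3 : (u + w) * m = u - w := by rw [hm]; field_simp
    have e4 := (hsum m hm1).tsum_eq
    simp only [hD, e4, infoGain, e1, e2]
    rw [hhA, hhB]
    linear_combination (-k₁ : ℝ) * e3
  · intro V _ z M hz hM hpos
    have e : ∑ i, ∑ j, z i * z j * D (M i j)
        = ∑' l, g l * ∑ i, ∑ j, z i * z j * M i j ^ (l + 2) := by
      have h1 : HasSum (fun l => ∑ i, ∑ j, z i * z j * (g l * M i j ^ (l + 2)))
          (∑ i, ∑ j, z i * z j * ∑' l, g l * M i j ^ (l + 2)) :=
        hasSum_sum fun i _ => hasSum_sum fun j _ =>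
          ((hsum (M i j) (hM i j)).summable.hasSum).mul_left _
      have h2 : ∑ i, ∑ j, z i * z j * D (M i j)
          = ∑ i, ∑ j, z i * z j * ∑' l, g l * M i j ^ (l + 2) := by
        simp only [hD, mul_add _ (k₀ + (hA + hB) / 2), Finset.sum_add_distrib]
        simp only [← Finset.sum_mul, ← Finset.mul_sum, hz, mul_zero, zero_mul,
          Finset.sum_const_zero, zero_add]
      rw [h2, ← h1.tsum_eq]
      refine tsum_congr fun l => ?_
      rw [Finset.mul_sum]
      refine Finset.sum_congr rfl fun i _ => ?_
      rw [Finset.mul_sum]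
      exact Finset.sum_congr rfl fun j _ => by ring
    rw [e]
    exact tsum_nonneg fun l => mul_nonneg (hg l) (hpos _)

/-- Schur's theorem for the powers of a Gram matrix. -/
lemma sum_mul_gram_pow_nonneg {V X : Type*} [Fintype V] [Fintype X] {p : X → ℝ} (hp : ∀ x, 0 ≤ p x)
    (σ : X → V → ℝ) (l : ℕ) (z : V → ℝ) :
    0 ≤ ∑ i, ∑ j, z i * z j * (∑ x, p x * (σ x i * σ x j)) ^ l := by
  induction l generalizing z with
  | zero =>
    simp only [pow_zero, mul_one, ← Finset.mul_sum, ← Finset.sum_mul]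
    exact mul_self_nonneg _
  | succ l ih =>
    have e : ∑ i, ∑ j, z i * z j * (∑ x, p x * (σ x i * σ x j)) ^ (l + 1)
        = ∑ x, p x * ∑ i, ∑ j, (z i * σ x i) * (z j * σ x j)
          * (∑ x, p x * (σ x i * σ x j)) ^ l := by
      have h : ∀ i j, z i * z j * (∑ x, p x * (σ x i * σ x j)) ^ (l + 1)
          = ∑ x, p x * ((z i * σ x i) * (z j * σ x j) * (∑ x, p x * (σ x i * σ x j)) ^ l) := by
        intro i j
        rw [pow_succ', Finset.sum_mul, Finset.mul_sum]
        exact Finset.sum_congr rfl fun x _ => by ring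
      simp only [h, Finset.mul_sum]
      rw [Finset.sum_congr rfl fun i _ => Finset.sum_comm, Finset.sum_comm]
    rw [e]
    exact Finset.sum_nonneg fun x _ => mul_nonneg (hp x) (ih _)

/-! ### The entropy is nearly subadditive in the number of vertices -/

lemma disjoint_powersetCard_two {V : Type*} {S T : Finset V} (hST : Disjoint S T) :
    Disjoint (S.powersetCard 2) (T.powersetCard 2) := by
  rw [Finset.disjoint_left]
  intro I hS hT
  rw [Finset.mem_powersetCard] at hS hT
  have := Finset.disjoint_of_subset_left hS.1 (Finset.disjoint_of_subset_right hT.1 hST)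
  rw [Finset.disjoint_self_iff_empty] at this
  simp [this] at hS

section Blocks

variable {V : Type} [DecidableEq V]

lemma sum_sum_pair (E : Finset V → ℝ) (B : Finset V) :
    ∑ i ∈ B, ∑ j ∈ B, E {i, j} = 2 * ∑ I ∈ B.powersetCard 2, E I + ∑ i ∈ B, E {i} := by
  induction B using Finset.induction_on with
  | empty =>
    rw [Finset.powersetCard_eq_empty.2 (by simp)]
    simp
  | insert a B ha ih =>
    have h1 : ∑ I ∈ (insert a B).powersetCard 2, E I
        = ∑ I ∈ B.powersetCard 2, E I + ∑ j ∈ B, E {a, j} := by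
      rw [Finset.powersetCard_succ_insert ha, Finset.sum_union, Finset.powersetCard_one,
        Finset.sum_image]
      · simp only [Finset.sum_map]; rfl
      · intro I hI J hJ h
        simp only [Finset.coe_map, Set.mem_image, Finset.mem_coe] at hI hJ
        obtain ⟨i, hi, rfl⟩ := hI
        obtain ⟨j, hj, rfl⟩ := hJ
        have hai : i ≠ a := fun h => ha (h ▸ hi)
        have : i ∈ insert a ({j} : Finset V) := by
          have h' : insert a ({i} : Finset V) = insert a {j} := h
          rw [← h']; simp
        have : i = j := by simpa [hai] using this
        rw [this]
      · rw [Finset.disjoint_left]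
        intro I hI hI'
        obtain ⟨J, _, rfl⟩ := Finset.mem_image.1 hI'
        exact ha ((Finset.mem_powersetCard.1 hI).1 (Finset.mem_insert_self a J))
    have h2 : ∀ i, E {i, a} = E {a, i} := fun i => by rw [Finset.pair_comm]
    rw [Finset.sum_insert ha, Finset.sum_insert ha, Finset.sum_insert ha, h1]
    simp only [Finset.sum_insert ha, Finset.sum_add_distrib, h2, Finset.pair_eq_singleton]
    rw [ih]
    ring

/-- For a kernel `E` that is positive semidefinite on vectors of sum zero, the mean of `E` over the
ordered pairs of vertices is at most the mean, weighted by `|S|` and `|T|`, of its means over the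
ordered pairs of `S` and of `T`.  The diagonal and the deviation of `lam n` from `2 γ / n` contribute
the constant. -/
lemma sum_pairs_sub_le [Fintype V] {E : Finset V → ℝ} {B : ℝ} (hE : ∀ I, |E I| ≤ B)
    (hpos : ∀ z : V → ℝ, ∑ i, z i = 0 → 0 ≤ ∑ i, ∑ j, z i * z j * E {i, j})
    {S T : Finset V} (hST : Disjoint S T) (hU : S ∪ T = Finset.univ) (hS : S.Nonempty)
    (hT : T.Nonempty) {lam : ℕ → ℝ} {γ K : ℝ} (hγ : 0 ≤ γ)
    (hlam : ∀ n : ℕ, 1 ≤ n → |lam n - 2 * γ / n| ≤ K / n ^ 2) :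
    lam (Fintype.card V) * ∑ I ∈ Finset.univ.powersetCard 2, E I
        - lam S.card * ∑ I ∈ S.powersetCard 2, E I - lam T.card * ∑ I ∈ T.powersetCard 2, E I
      ≤ 3 * (γ + K) * B := by
  have hB : 0 ≤ B := (abs_nonneg _).trans (hE ∅)
  have single : ∀ W : Finset V, W.Nonempty →
      |lam W.card * ∑ I ∈ W.powersetCard 2, E I
        - γ / W.card * ∑ i ∈ W, ∑ j ∈ W, E {i, j}| ≤ (γ + K) * B := by
    intro W hW
    have hn : 1 ≤ W.card := hW.card_pos
    have hn0 : (0 : ℝ) < W.card := by exact_mod_cast hn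
    have hK : 0 ≤ K / (W.card : ℝ) ^ 2 := (abs_nonneg _).trans (hlam _ hn)
    have hs : |∑ I ∈ W.powersetCard 2, E I| ≤ W.card ^ 2 / 2 * B := by
      refine (Finset.abs_sum_le_sum_abs _ _).trans ((Finset.sum_le_sum fun I _ => hE I).trans ?_)
      rw [Finset.sum_const, Finset.card_powersetCard, nsmul_eq_mul]
      exact mul_le_mul_of_nonneg_right (choose_two_le _) hB
    have hd : |∑ i ∈ W, E {i}| ≤ W.card * B := by
      refine (Finset.abs_sum_le_sum_abs _ _).trans ((Finset.sum_le_sum fun i _ => hE {i}).trans ?_)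
      rw [Finset.sum_const, nsmul_eq_mul]
    have e : lam W.card * ∑ I ∈ W.powersetCard 2, E I
        - γ / W.card * ∑ i ∈ W, ∑ j ∈ W, E {i, j}
        = (lam W.card - 2 * γ / W.card) * ∑ I ∈ W.powersetCard 2, E I
          - γ / W.card * ∑ i ∈ W, E {i} := by
      rw [sum_sum_pair]; ring
    rw [e]
    refine (abs_sub _ _).trans ?_
    rw [abs_mul, abs_mul, abs_of_nonneg (by positivity : 0 ≤ γ / (W.card : ℝ))]
    have h1 : |lam W.card - 2 * γ / W.card| * |∑ I ∈ W.powersetCard 2, E I|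
        ≤ K / W.card ^ 2 * (W.card ^ 2 / 2 * B) :=
      mul_le_mul (hlam _ hn) hs (abs_nonneg _) hK
    have h2 : γ / W.card * |∑ i ∈ W, E {i}| ≤ γ / W.card * (W.card * B) := by gcongr
    have h3 : K / (W.card : ℝ) ^ 2 * (W.card ^ 2 / 2 * B) = K * B / 2 := by field_simp
    have h4 : γ / (W.card : ℝ) * (W.card * B) = γ * B := by field_simp
    have h5 : 0 ≤ K * B / 2 := by rw [← h3]; positivity
    rw [h3] at h1
    rw [h4] at h2
    linarith
  have hn : (0 : ℝ) < S.card := by exact_mod_cast hS.card_pos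
  have hm : (0 : ℝ) < T.card := by exact_mod_cast hT.card_pos
  have hc : (Fintype.card V : ℝ) = S.card + T.card := by
    rw [← Finset.card_univ, ← hU, Finset.card_union_of_disjoint hST]; push_cast; rfl
  have split : ∀ f : V → ℝ, ∑ i, f i = ∑ i ∈ S, f i + ∑ i ∈ T, f i := fun f => by
    rw [← hU, Finset.sum_union hST]
  -- the test vector `1_S / |S| - 1_T / |T|`
  obtain ⟨z, zS, zT⟩ : ∃ z : V → ℝ,
      (∀ f : V → ℝ, ∑ i ∈ S, z i * f i = (S.card : ℝ)⁻¹ * ∑ i ∈ S, f i) ∧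
      ∀ f : V → ℝ, ∑ i ∈ T, z i * f i = -(T.card : ℝ)⁻¹ * ∑ i ∈ T, f i := by
    refine ⟨fun i => if i ∈ S then (S.card : ℝ)⁻¹ else -(T.card : ℝ)⁻¹, fun f => ?_, fun f => ?_⟩
    · rw [Finset.mul_sum]; exact Finset.sum_congr rfl fun i hi => by
        simp only [if_pos hi]
    · rw [Finset.mul_sum]
      exact Finset.sum_congr rfl fun i hi => by
        simp only [if_neg fun h => Finset.disjoint_left.1 hST h hi]
  have hz0 : ∑ i, z i = 0 := by
    have h1 := zS fun _ => 1
    have h2 := zT fun _ => 1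
    simp only [mul_one, Finset.sum_const, nsmul_eq_mul] at h1 h2
    rw [split, h1, h2]
    field_simp
    ring
  have hz := hpos z hz0
  have e : ∀ i, ∑ j, z i * z j * E {i, j} = z i * ((S.card : ℝ)⁻¹ * ∑ j ∈ S, E {i, j}
      + -(T.card : ℝ)⁻¹ * ∑ j ∈ T, E {i, j}) := by
    intro i
    simp only [mul_assoc]
    rw [← Finset.mul_sum, split, zS, zT]
  simp only [e] at hz
  rw [split, zS, zT] at hz
  simp only [Finset.sum_add_distrib, ← Finset.mul_sum] at hz
  have sU := abs_le.1 (single Finset.univ (by rw [← hU]; exact hS.mono Finset.subset_union_left))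
  have sS := abs_le.1 (single S hS)
  have sT := abs_le.1 (single T hT)
  rw [Finset.card_univ, hc] at sU
  simp only [split, Finset.sum_add_distrib] at sU
  set X₁ := ∑ i ∈ S, ∑ j ∈ S, E {i, j}
  set X₂ := ∑ i ∈ T, ∑ j ∈ T, E {i, j}
  set Y₁ := ∑ i ∈ S, ∑ j ∈ T, E {i, j}
  set Y₂ := ∑ i ∈ T, ∑ j ∈ S, E {i, j}
  have key : γ / (S.card + T.card) * (X₁ + Y₁ + (Y₂ + X₂)) ≤ γ / S.card * X₁ + γ / T.card * X₂ := by
    have h : γ / S.card * X₁ + γ / T.card * X₂ - γ / (S.card + T.card) * (X₁ + Y₁ + (Y₂ + X₂))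
        = γ * (S.card * T.card / (S.card + T.card)) *
          ((S.card : ℝ)⁻¹ * ((S.card : ℝ)⁻¹ * X₁ + -(T.card : ℝ)⁻¹ * Y₁)
            + -(T.card : ℝ)⁻¹ * ((S.card : ℝ)⁻¹ * Y₂ + -(T.card : ℝ)⁻¹ * X₂)) := by
      field_simp
      ring
    have := mul_nonneg (mul_nonneg hγ
      (by positivity : (0 : ℝ) ≤ S.card * T.card / (S.card + T.card))) hz
    linarith
  linarith [sU.2, sS.1, sT.1]

/-- `1` if the assignment `x` is constant on `I`, and `-1` otherwise. -/
def pairSign (I : Finset V) (x : V → Fin 2) : ℝ := if Agree I x then 1 else -1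

/-- The communities as signs. -/
def spin (u : Fin 2) : ℝ := if u = 0 then 1 else -1

lemma pairSign_pair (i j : V) (x : V → Fin 2) :
    pairSign {i, j} x = spin (x i) * spin (x j) := by
  have h : Agree {i, j} x ↔ x i = x j := by
    constructor
    · intro h; exact h i (by simp) j (by simp)
    · intro h k hk l hl
      simp only [Finset.mem_insert, Finset.mem_singleton] at hk hl
      rcases hk with rfl | rfl <;> rcases hl with rfl | rfl <;> simp [h]
  rw [pairSign, if_congr h rfl rfl]
  generalize x i = p
  generalize x j = q
  fin_cases p <;> fin_cases q <;> simp [spin]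

lemma weightOf_sub_not [Fintype V] (I : Finset V) (v : (V → Fin 2) → ℝ) :
    weightOf (Agree I) v - weightOf (fun x => ¬ Agree I x) v = ∑ x, v x * pairSign I x := by
  simp only [pairSign, sum_mul_ite]
  ring

/-- Under a uniform assignment the communities of two vertices are uncorrelated. -/
lemma sum_pairSign [Fintype V] {I : Finset V} (hI : I.card = 2) :
    ∑ x : V → Fin 2, pairSign I x = 0 := by
  obtain ⟨i, j, hij, rfl⟩ := Finset.card_eq_two.1 hI
  have h := Equiv.sum_comp (Equiv.addRight (Pi.single i 1 : V → Fin 2)) (pairSign {i, j})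
  have h2 : ∀ x : V → Fin 2, pairSign {i, j} (Equiv.addRight (Pi.single i 1) x)
      = -pairSign {i, j} x := by
    intro x
    have hs : ∀ u : Fin 2, spin (u + 1) = -spin u := by
      intro u; fin_cases u <;> simp [spin]
    simp [pairSign_pair, hs, hij.symm]
  simp only [h2, Finset.sum_neg_distrib] at h
  linarith

/-- The sums of the signs of the pair `I` over the columns. -/
noncomputable def signSum [Fintype V] (I : Finset V) : FormalChannel (V → Fin 2) →ₗ[ℝ] ℝ :=
  (∑ x, pairSign I x • LinearMap.proj x) ∘ₗ columnSum.toLinearMap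

lemma signSum_single [Fintype V] (I : Finset V) (v : (V → Fin 2) → ℝ) :
    signSum I (MonoidAlgebra.single v 1) = ∑ x, v x * pairSign I x := by
  simp [signSum, mul_comm]

lemma IsChannel.signSum_eq_zero [Fintype V] {I : Finset V} (hI : I.card = 2)
    {c : FormalChannel (V → Fin 2)} (hc : IsChannel c) : signSum I c = 0 := by
  simp [signSum, hc.columnSum_eq, sum_pairSign hI]

/-- The rates that keep the observations inside `S` and inside `T` only. -/
def blockRate (lam : ℕ → ℝ) (S T I : Finset V) : ℝ :=
  if I ∈ S.powersetCard 2 then lam S.card else if I ∈ T.powersetCard 2 then lam T.card else 0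

lemma blockRate_of_mem_right {lam : ℕ → ℝ} {S T : Finset V} (hST : Disjoint S T) {I : Finset V}
    (hI : I ∈ T.powersetCard 2) : blockRate lam S T I = lam T.card := by
  rw [blockRate, if_neg (fun h => Finset.disjoint_left.1 (disjoint_powersetCard_two hST) h hI),
    if_pos hI]

lemma sum_blockRate_mul [Fintype V] (lam : ℕ → ℝ) {S T : Finset V} (hST : Disjoint S T)
    (E : Finset V → ℝ) :
    ∑ I ∈ (Finset.univ : Finset V).powersetCard 2, blockRate lam S T I * E I
      = lam S.card * ∑ I ∈ S.powersetCard 2, E I + lam T.card * ∑ I ∈ T.powersetCard 2, E I := by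
  rw [← Finset.sum_subset (s₁ := S.powersetCard 2 ∪ T.powersetCard 2), Finset.sum_union
    (disjoint_powersetCard_two hST), Finset.mul_sum, Finset.mul_sum]
  · congr 1
    · exact Finset.sum_congr rfl fun I hI => by rw [blockRate, if_pos hI]
    · exact Finset.sum_congr rfl fun I hI => by rw [blockRate_of_mem_right hST hI]
  · exact Finset.union_subset (Finset.powersetCard_mono (Finset.subset_univ _))
      (Finset.powersetCard_mono (Finset.subset_univ _))
  · intro I _ hI
    rw [Finset.mem_union, not_or] at hI
    rw [blockRate, if_neg hI.1, if_neg hI.2, zero_mul]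

lemma prod_erasure_blockRate [Fintype V] (lam : ℕ → ℝ) {S T : Finset V} (hST : Disjoint S T)
    {A : Type*} (Q : Finset V → FormalChannel A) :
    ∏ I ∈ (Finset.univ : Finset V).powersetCard 2, erasure (blockRate lam S T I) (Q I)
      = (∏ I ∈ S.powersetCard 2, erasure (lam S.card) (Q I))
        * ∏ I ∈ T.powersetCard 2, erasure (lam T.card) (Q I) := by
  rw [← Finset.prod_subset (s₁ := S.powersetCard 2 ∪ T.powersetCard 2), Finset.prod_union
    (disjoint_powersetCard_two hST)]
  · congr 1
    · exact Finset.prod_congr rfl fun I hI => by rw [blockRate, if_pos hI]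
    · exact Finset.prod_congr rfl fun I hI => by rw [blockRate_of_mem_right hST hI]
  · exact Finset.union_subset (Finset.powersetCard_mono (Finset.subset_univ _))
      (Finset.powersetCard_mono (Finset.subset_univ _))
  · intro I _ hI
    rw [Finset.mem_union, not_or] at hI
    rw [blockRate, if_neg hI.1, if_neg hI.2, erasure, zero_smul, add_zero]

/-- Moving the observations of all pairs into the parts `S` and `T` lowers the conditional entropy by
a bounded amount at most.  (`entropy` is the conditional entropy times the number of assignments.) -/
lemma exists_entropy_le_blocks {α β : ℝ} (hα : 0 < α) (hαβ : α ≤ β) (hs : α + β ≤ 1)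
    (hβ : β ≤ 1) {lam : ℕ → ℝ} {γ K : ℝ} (hγ : 0 ≤ γ) (l0 : ∀ n, 0 ≤ lam n) (l1 : ∀ n, lam n ≤ 1)
    (hlam : ∀ n : ℕ, 1 ≤ n → |lam n - 2 * γ / n| ≤ K / n ^ 2) :
    ∃ C, ∀ (V : Type) [DecidableEq V] [Fintype V] (S T : Finset V), Disjoint S T →
      S ∪ T = Finset.univ → S.Nonempty → T.Nonempty →
      entropy (∏ I ∈ (Finset.univ : Finset V).powersetCard 2,
          erasure (lam (Fintype.card V)) (pairChannel α β I))
        ≤ entropy (∏ I ∈ (Finset.univ : Finset V).powersetCard 2,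
          erasure (blockRate lam S T I) (pairChannel α β I)) + C * Fintype.card (V → Fin 2) := by
  obtain ⟨κ, B, D, hD, hgain, hpos⟩ := exists_infoGain_eq hα hαβ hs
  refine ⟨3 * (γ + K) * B + Real.log 2 * (3 / 2 * (2 * γ + K) ^ 2), ?_⟩
  intro V _ _ S T hST hU hS hT
  have hK : 0 ≤ K := by simpa using (abs_nonneg _).trans (hlam 1 le_rfl)
  have sq : ∀ W : Finset V, W.Nonempty →
      ∑ I ∈ W.powersetCard 2, lam W.card ^ 2 ≤ 1 / 2 * (2 * γ + K) ^ 2 := by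
    intro W hW
    have hn : (1 : ℝ) ≤ W.card := by exact_mod_cast hW.card_pos
    have h1 : lam W.card ≤ (2 * γ + K) / W.card := by
      have h2 := (abs_le.1 (hlam W.card hW.card_pos)).2
      have h3 : K / (W.card : ℝ) ^ 2 ≤ K / W.card := by
        gcongr
        nlinarith
      rw [add_div]; linarith
    rw [Finset.sum_const, Finset.card_powersetCard, nsmul_eq_mul]
    calc (W.card.choose 2 : ℝ) * lam W.card ^ 2
        ≤ W.card ^ 2 / 2 * ((2 * γ + K) / W.card) ^ 2 := by
          gcongr
          · exact choose_two_le _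
          · exact l0 _
      _ = _ := by field_simp
  have main := entropy_prod_erasure_le ((Finset.univ : Finset V).powersetCard 2)
    (K := pairChannel α β) (p := blockRate lam S T) (q := fun _ => lam (Fintype.card V))
    (C := 3 * (γ + K) * B) (L := Real.log 2)
    (fun I _ => isChannel_pairChannel hα.le (hαβ.trans hβ) (hα.le.trans hαβ) hβ I)
    (fun I _ c hc => entropy_mul_statChannel_sub_one (Agree I)
      (bern_nonneg hα.le (hαβ.trans hβ)) (bern_nonneg (hα.le.trans hαβ) hβ) (sum_bern _)
      (sum_bern _) hc)
    (fun I => by unfold blockRate; split_ifs <;> simp [l0])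
    (fun I => by unfold blockRate; split_ifs <;> simp [l1])
    (fun _ => l0 _) (fun _ => l1 _) ?_
  · refine main.trans ?_
    gcongr
    · have h1 : ∑ I ∈ (Finset.univ : Finset V).powersetCard 2, blockRate lam S T I ^ 2
          = ∑ I ∈ S.powersetCard 2, lam S.card ^ 2 + ∑ I ∈ T.powersetCard 2, lam T.card ^ 2 := by
        simp only [pow_two]
        rw [sum_blockRate_mul lam hST, Finset.mul_sum, Finset.mul_sum]
        congr 1
        · exact Finset.sum_congr rfl fun I hI => by rw [blockRate, if_pos hI]
        · exact Finset.sum_congr rfl fun I hI => by rw [blockRate_of_mem_right hST hI]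
      have h2 := sq Finset.univ (by rw [← hU]; exact hS.mono Finset.subset_union_left)
      rw [Finset.card_univ] at h2
      rw [Finset.sum_add_distrib, h1]
      linarith [sq S hS, sq T hT]
  · intro c hc
    let f : FormalChannel (V → Fin 2) →ₗ[ℝ] ℝ :=
      ∑ I ∈ (Finset.univ : Finset V).powersetCard 2, (lam (Fintype.card V) - blockRate lam S T I) •
        (entropy ∘ₗ LinearMap.mulRight ℝ (pairChannel α β I - 1) - κ • signSum I)
    have hfc : f c = ∑ I ∈ (Finset.univ : Finset V).powersetCard 2,
        (lam (Fintype.card V) - blockRate lam S T I) * entropy (c * (pairChannel α β I - 1)) := by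
      simp only [f, LinearMap.sum_apply, LinearMap.smul_apply, LinearMap.sub_apply,
        LinearMap.comp_apply, LinearMap.mulRight_apply, smul_eq_mul]
      refine Finset.sum_congr rfl fun I hI => ?_
      rw [hc.signSum_eq_zero (Finset.mem_powersetCard.1 hI).2, mul_zero, sub_zero]
    rw [← hfc]
    refine hc.linear_le fun v hv => ?_
    set t := ∑ x, v x with ht
    have ht0 : 0 ≤ t := Finset.sum_nonneg fun x _ => hv x
    -- the correlation of the pair `I` under the distribution proportional to `v`
    set m := fun I : Finset V => (∑ x, v x * pairSign I x) / t with hm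
    have hm1 : ∀ I, |m I| ≤ 1 := by
      intro I
      rw [hm, abs_div, abs_of_nonneg ht0]
      refine div_le_one_of_le₀ ?_ ht0
      refine (Finset.abs_sum_le_sum_abs _ _).trans (Finset.sum_le_sum fun x _ => ?_)
      rw [abs_mul, abs_of_nonneg (hv x), pairSign]
      split_ifs <;> simp
    have hfv : f (MonoidAlgebra.single v 1)
        = t * ∑ I ∈ (Finset.univ : Finset V).powersetCard 2,
          (lam (Fintype.card V) - blockRate lam S T I) * D (m I) := by
      simp only [f, LinearMap.sum_apply, LinearMap.smul_apply, LinearMap.sub_apply,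
        LinearMap.comp_apply, LinearMap.mulRight_apply, smul_eq_mul, signSum_single]
      rw [Finset.mul_sum]
      refine Finset.sum_congr rfl fun I _ => ?_
      have e := entropy_single_mul_statChannel (Agree I) (sum_bern α) (sum_bern β) hv
      rw [sum_infoGain_bern, hgain _ _ (weightOf_nonneg _ hv) (weightOf_nonneg _ hv),
        weightOf_sub_not, weightOf_add_not, ← ht] at e
      rw [pairChannel, e]
      ring
    rw [hfv]
    simp only [sub_mul, Finset.sum_sub_distrib, ← Finset.mul_sum]
    rw [sum_blockRate_mul lam hST, mul_comm t, ← sub_sub]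
    refine mul_le_mul_of_nonneg_right ?_ ht0
    refine sum_pairs_sub_le (fun I => hD _ (hm1 I)) (fun z hz => ?_) hST hU hS hT hγ hlam
    refine hpos V z (fun i j => m {i, j}) hz (fun i j => hm1 _) fun l => ?_
    have := sum_mul_gram_pow_nonneg (p := fun x => v x / t) (fun x => div_nonneg (hv x) ht0)
      (fun (x : V → Fin 2) i => spin (x i)) l z
    simp only [hm, pairSign_pair, Finset.sum_div]
    simpa only [mul_div_right_comm] using this

end Blocks

/-! ### Independent parts -/

section Pullback

variable {A A₁ A₂ : Type*}

/-- The channel that applies `c` to the image of the input under `π`. -/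
noncomputable def pullback (π : A → A₁) : FormalChannel A₁ →ₐ[ℝ] FormalChannel A :=
  MonoidAlgebra.lift ℝ (FormalChannel A) (A₁ → ℝ)
    ((MonoidAlgebra.of ℝ (A → ℝ)).comp
      { toFun := fun v => v ∘ π, map_one' := rfl, map_mul' := fun _ _ => rfl })

lemma pullback_single (π : A → A₁) (v : A₁ → ℝ) (r : ℝ) :
    pullback π (MonoidAlgebra.single v r) = MonoidAlgebra.single (v ∘ π) r := by
  simp [pullback, MonoidAlgebra.lift_single]

lemma pullback_erasure (π : A → A₁) (t : ℝ) (c : FormalChannel A₁) :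
    pullback π (erasure t c) = erasure t (pullback π c) := by
  simp [erasure]

lemma pullback_pairChannel {V V₁ : Type*} (e : V₁ ↪ V) (α β : ℝ) (I : Finset V₁) :
    pullback (fun x : V → Fin 2 => x ∘ e) (pairChannel α β I) = pairChannel α β (I.map e) := by
  simp only [pairChannel, statChannel, map_sum, pullback_single]
  refine Finset.sum_congr rfl fun z _ => ?_
  congr 1
  ext x
  have : Agree I (x ∘ e) ↔ Agree (I.map e) x := by simp [Agree]
  simp only [Function.comp_apply, if_congr this rfl rfl]

variable [Fintype A] [Fintype A₁] [Fintype A₂]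

/-- The chain rule for independent parts of the input observed separately. -/
lemma entropy_pullback_mul (e : A₁ × A₂ ≃ A) (c₁ : FormalChannel A₁) (c₂ : FormalChannel A₂) :
    entropy (pullback (fun x => (e.symm x).1) c₁ * pullback (fun x => (e.symm x).2) c₂)
      = (∑ x, columnSum c₂ x) * entropy c₁ + (∑ x, columnSum c₁ x) * entropy c₂ := by
  induction c₁ using MonoidAlgebra.induction_linear with
  | zero => simp
  | add f g hf hg =>
    simp only [map_add, add_mul, hf, hg, Pi.add_apply, Finset.sum_add_distrib]; ring
  | single v r =>
    induction c₂ using MonoidAlgebra.induction_linear with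
    | zero => simp
    | add f g hf hg =>
      simp only [map_add, mul_add, hf, hg, Pi.add_apply, Finset.sum_add_distrib]; ring
    | single w s =>
      have h : ∀ F : A₁ → A₂ → ℝ, ∑ x, F (e.symm x).1 (e.symm x).2 = ∑ x, ∑ y, F x y := by
        intro F
        rw [← Equiv.sum_comp e, Fintype.sum_prod_type]
        simp
      have hc : columnEntropy ((v ∘ fun x => (e.symm x).1) * (w ∘ fun x => (e.symm x).2))
          = (∑ y, w y) * columnEntropy v + (∑ x, v x) * columnEntropy w := by
        have h1 := h fun x y => negMulLog (v x * w y)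
        have h2 := h fun x y => v x * w y
        simp only [columnEntropy, Pi.mul_apply, Function.comp_apply]
        rw [h1, h2]
        simp only [← Finset.mul_sum, ← Finset.sum_mul, Real.negMulLog_mul, Finset.sum_add_distrib]
        ring
      simp only [pullback_single, MonoidAlgebra.single_mul_single, entropy_single, hc,
        columnSum_single, Pi.smul_apply, smul_eq_mul, ← Finset.mul_sum]
      ring

end Pullback

lemma sparseEntropy_eq (a b γ : ℝ) (n : ℕ) : sparseEntropy a b γ n =
    entropy (∏ I ∈ (Finset.univ : Finset (Fin n)).powersetCard 2,
      erasure (copyProb γ n) (pairChannel (a / (2 * γ)) (b / (2 * γ)) I)) := by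
  rw [sparseEntropy, Finset.prod_subtype (p := fun I : Finset (Fin n) => I.card = 2)]
  intro I
  simp [Finset.mem_powersetCard]

/-- With observations inside two blocks only, the entropies add. -/
lemma entropy_prod_erasure_blocks (α β s t : ℝ) (m n : ℕ) (hα : 0 ≤ α) (hα1 : α ≤ 1) (hβ : 0 ≤ β)
    (hβ1 : β ≤ 1) (hs : 0 ≤ s) (hs1 : s ≤ 1) (ht : 0 ≤ t) (ht1 : t ≤ 1) :
    entropy ((∏ I ∈ (Finset.univ.map (Fin.castAddEmb (n := m) n)).powersetCard 2,
        erasure s (pairChannel α β I))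
      * ∏ I ∈ (Finset.univ.map (Fin.natAddEmb (m := n) m)).powersetCard 2,
        erasure t (pairChannel α β I))
      = 2 ^ n * entropy (∏ I ∈ (Finset.univ : Finset (Fin m)).powersetCard 2,
          erasure s (pairChannel α β I))
        + 2 ^ m * entropy (∏ I ∈ (Finset.univ : Finset (Fin n)).powersetCard 2,
          erasure t (pairChannel α β I)) := by
  have h := entropy_pullback_mul (Fin.appendEquiv (α := Fin 2) m n)
    (∏ I ∈ (Finset.univ : Finset (Fin m)).powersetCard 2, erasure s (pairChannel α β I))
    (∏ I ∈ (Finset.univ : Finset (Fin n)).powersetCard 2, erasure t (pairChannel α β I))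
  rw [(IsChannel.prod _ fun I _ =>
      (isChannel_pairChannel hα hα1 hβ hβ1 I).erasure hs hs1).columnSum_eq,
    (IsChannel.prod _ fun I _ =>
      (isChannel_pairChannel hα hα1 hβ hβ1 I).erasure ht ht1).columnSum_eq] at h
  have e1 : (fun x => ((Fin.appendEquiv (α := Fin 2) m n).symm x).1)
      = fun x => x ∘ Fin.castAddEmb (n := m) n := rfl
  have e2 : (fun x => ((Fin.appendEquiv (α := Fin 2) m n).symm x).2)
      = fun x => x ∘ Fin.natAddEmb (m := n) m := rfl
  rw [e1, e2] at h
  simp only [map_prod, pullback_erasure, pullback_pairChannel] at h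
  rw [Finset.powersetCard_map, Finset.powersetCard_map, Finset.prod_map, Finset.prod_map]
  simpa using h

/-- Subadditivity, up to a constant, of the conditional entropy of the sparse erased model. -/
lemma exists_sparseEntropy_add_le {a b γ : ℝ} (ha : 0 < a) (hab : a ≤ b) (hγ : b ≤ γ) :
    ∃ C, ∀ m n : ℕ, sparseEntropy a b γ (m + n) / 2 ^ (m + n)
      ≤ sparseEntropy a b γ m / 2 ^ m + sparseEntropy a b γ n / 2 ^ n + C := by
  have hγ0 : 0 < γ := by linarith
  have hg : 0 < 2 * γ := by linarith
  have q0 : 0 < a / (2 * γ) := by positivity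
  have qab : a / (2 * γ) ≤ b / (2 * γ) := by gcongr
  have q2 : b / (2 * γ) ≤ 1 / 2 := by rw [div_le_div_iff₀ hg two_pos]; linarith
  obtain ⟨C, hC⟩ := exists_entropy_le_blocks q0 qab (by linarith) (by linarith) hγ0.le
    (copyProb_nonneg hγ0.le) (copyProb_le_one γ) fun n hn => abs_copyProb_sub_le hγ0.le hn
  have zero : sparseEntropy a b γ 0 = 0 := by
    rw [sparseEntropy_eq, Finset.powersetCard_eq_empty.2 (by simp), Finset.prod_empty,
      MonoidAlgebra.one_def, entropy_single]
    simp [columnEntropy]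
  refine ⟨max C 0, fun m n => ?_⟩
  rcases m.eq_zero_or_pos with rfl | hm
  · simp [zero]
  rcases n.eq_zero_or_pos with rfl | hn
  · simp [zero]
  have hdis : Disjoint (Finset.univ.map (Fin.castAddEmb (n := m) n))
      (Finset.univ.map (Fin.natAddEmb (m := n) m)) := by
    rw [Finset.disjoint_left]
    intro i hi hj
    obtain ⟨k, _, rfl⟩ := Finset.mem_map.1 hi
    obtain ⟨l, _, hl⟩ := Finset.mem_map.1 hj
    have := congrArg Fin.val hl
    simp at this
    omega
  have huni : Finset.univ.map (Fin.castAddEmb (n := m) n)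
      ∪ Finset.univ.map (Fin.natAddEmb (m := n) m) = Finset.univ := by
    ext i
    induction i using Fin.addCases with
    | left i => simp
    | right i => simp
  have h := hC (Fin (m + n)) _ _ hdis huni ((Finset.univ_nonempty_iff.2 ⟨⟨0, hm⟩⟩).map)
    ((Finset.univ_nonempty_iff.2 ⟨⟨0, hn⟩⟩).map)
  rw [prod_erasure_blockRate _ hdis, entropy_prod_erasure_blocks _ _ _ _ _ _ q0.le (by linarith)
    (by linarith) (by linarith) (copyProb_nonneg hγ0.le _) (copyProb_le_one γ _)
    (copyProb_nonneg hγ0.le _) (copyProb_le_one γ _)] at h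
  simp only [Fintype.card_fin, Finset.card_map, Finset.card_univ, Fintype.card_pi,
    Finset.prod_const, ← sparseEntropy_eq, Nat.cast_pow, Nat.cast_ofNat] at h
  have e : sparseEntropy a b γ m / 2 ^ m + sparseEntropy a b γ n / 2 ^ n
      = (2 ^ n * sparseEntropy a b γ m + 2 ^ m * sparseEntropy a b γ n) / 2 ^ (m + n) := by
    rw [pow_add]; field_simp
  rw [e, ← sub_le_iff_le_add', ← sub_div, div_le_iff₀ (by positivity)]
  have := mul_le_mul_of_nonneg_right (le_max_left C 0) (by positivity : (0 : ℝ) ≤ 2 ^ (m + n))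
  linarith

/-! ### The limits -/

lemma IsChannel.entropy_nonneg {A : Type*} [Fintype A] {c : FormalChannel A} (hc : IsChannel c) :
    0 ≤ entropy c := by
  have := hc.linear_le (f := -entropy) (ε := 0) fun v hv => by
    have : ∀ s : Finset A, negMulLog (∑ x ∈ s, v x) ≤ ∑ x ∈ s, negMulLog (v x) := by
      classical
      intro s
      induction s using Finset.induction_on with
      | empty => simp
      | insert i s hi ih =>
        rw [Finset.sum_insert hi, Finset.sum_insert hi]
        exact (negMulLog_add_le (hv i) (Finset.sum_nonneg fun x _ => hv x)).trans
          (add_le_add le_rfl ih)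
    simp only [LinearMap.neg_apply, entropy_single, one_mul, zero_mul, neg_nonpos, columnEntropy]
    linarith [this Finset.univ]
  simpa using this

lemma exists_tendsto_sparseEntropy {a b γ : ℝ} (ha : 0 < a) (hab : a ≤ b) (hγ : b ≤ γ) :
    ∃ l, Tendsto (fun n : ℕ => sparseEntropy a b γ n / 2 ^ n / n) atTop (𝓝 l) := by
  obtain ⟨C, hC⟩ := exists_sparseEntropy_add_le ha hab hγ
  have hγ0 : 0 ≤ γ := by linarith
  set u := fun n : ℕ => sparseEntropy a b γ n / 2 ^ n + |C| with hu
  have hsub : Subadditive u := fun m n => by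
    have := hC m n
    simp only [hu]
    linarith [le_abs_self C]
  have h0 : ∀ n, 0 ≤ u n := fun n => by
    have : 0 ≤ sparseEntropy a b γ n := IsChannel.entropy_nonneg (IsChannel.prod _ fun I _ =>
      (isChannel_pairChannel_div ha hab (by linarith) I.1).erasure (copyProb_nonneg hγ0 n)
        (copyProb_le_one γ n))
    simp only [hu]
    positivity
  have hlim := hsub.tendsto_lim ⟨0, by
    rintro _ ⟨n, rfl⟩
    exact div_nonneg (h0 n) n.cast_nonneg⟩
  refine ⟨hsub.lim - 0, ?_⟩
  refine (hlim.sub (tendsto_const_div_atTop_nhds_zero_nat |C|)).congr fun n => ?_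
  simp only [hu]
  ring

end PlantedGraph

open PlantedGraph

theorem mainTheorem5 (a b : ℝ) (ha : 0 < a) (hab : a ≤ b) :
    ∃ (L : ℝ) (Lγ : ℝ → ℝ),
      Tendsto (fun n : ℕ => 1 / (n : ℝ) * PlantedGraph.sbmEntropy a b n) atTop (𝓝 L) ∧
      (∀ᶠ γ : ℝ in atTop,
        Tendsto (fun n : ℕ =>
            1 / (n : ℝ) * PlantedGraph.graphicalEntropy (PlantedGraph.sbmKernel a b γ) γ n)
          atTop (𝓝 (Lγ γ))) ∧
      Tendsto Lγ atTop (𝓝 L) := by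
  have hl2 : 0 < Real.log 2 := Real.log_pos one_lt_two
  have hb : 0 < b := by linarith
  choose! l hl using fun γ (hγ : b ≤ γ) => exists_tendsto_sparseEntropy ha hab hγ
  set Λ := fun γ => l γ / Real.log 2 with hΛ
  set h := fun n : ℕ => 1 / (n : ℝ) * sbmEntropy a b n with hh
  set s := fun (γ : ℝ) (n : ℕ) => sparseEntropy a b γ n / 2 ^ n / n / Real.log 2 with hs
  have hsl : ∀ γ, b ≤ γ → Tendsto (s γ) atTop (𝓝 (Λ γ)) := fun γ hγ => (hl γ hγ).div_const _
  have hgr : ∀ γ, b ≤ γ → Tendsto (fun n : ℕ =>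
      1 / (n : ℝ) * graphicalEntropy (sbmKernel a b γ) γ n) atTop (𝓝 (Λ γ)) := by
    intro γ hγ
    refine tendsto_of_tendsto_of_dist (hsl γ hγ) ?_
    refine squeeze_zero' (Eventually.of_forall fun _ => dist_nonneg) ?_
      (tendsto_const_div_atTop_nhds_zero_nat (4 * γ ^ 2))
    filter_upwards [eventually_ge_atTop 2] with n hn
    have hn0 : (0 : ℝ) < n := by positivity
    have := abs_integral_entropy_sub_sparse_le ha hab hγ hn
    have e : 1 / (n : ℝ) * graphicalEntropy (sbmKernel a b γ) γ n
        = (∫ m, entropy (∏ I : Edge 2 n, pairChannel (a / (2 * γ)) (b / (2 * γ)) I.1 ^ m I)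
          ∂(poissonEnsemble 2 γ n)) / 2 ^ n / n / Real.log 2 := by
      simp only [graphicalEntropy, condEntropy_graphicalChannel ha hab (by linarith : b ≤ 2 * γ)]
      rw [integral_div]
      field_simp
    rw [e, dist_comm, Real.dist_eq]
    simp only [hs]
    rw [← sub_div, ← sub_div, ← sub_div, abs_div, abs_div, abs_div, abs_of_pos hl2,
      abs_of_pos hn0, abs_of_pos (by positivity : (0 : ℝ) < 2 ^ n), div_le_iff₀ hl2,
      div_le_iff₀ hn0, div_le_iff₀ (by positivity)]
    refine this.trans_eq ?_
    field_simp
  set c := (a - b) ^ 2 / 2 / Real.log 2 with hc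
  -- the block model is within `c / γ` of the limit at `γ`, up to a vanishing error
  have hclose : ∀ γ, b ≤ γ → ∀ ε > 0, ∀ᶠ n in atTop, |h n - Λ γ| < c / γ + ε := by
    intro γ hγ ε hε
    obtain ⟨C, hC⟩ := abs_entropy_sbm_sub_sparse_le ha hab hγ
    have h1 := (hsl γ hγ).eventually (Metric.ball_mem_nhds _ (half_pos hε))
    have h2 := (tendsto_const_div_atTop_nhds_zero_nat (C / Real.log 2)).eventually
      (gt_mem_nhds (half_pos hε))
    have h3 := tendsto_natCast_atTop_atTop.eventually (eventually_ge_atTop (2 * b))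
    filter_upwards [h1, h2, h3] with n h1 h2 h3
    have hn0 : (0 : ℝ) < n := by linarith
    have e : h n = entropy (∏ I : Edge 2 n, pairChannel (a / n) (b / n) I.1)
        / 2 ^ n / n / Real.log 2 := by
      simp only [hh]
      rw [sbmEntropy_eq ha hab (by linarith)]
      field_simp
    have hd : |h n - s γ n| ≤ C / Real.log 2 / n + c / γ := by
      rw [e]
      simp only [hs]
      rw [← sub_div, ← sub_div, ← sub_div, abs_div, abs_div, abs_div, abs_of_pos hl2,
        abs_of_pos hn0, abs_of_pos (by positivity : (0 : ℝ) < 2 ^ n), div_le_iff₀ hl2,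
        div_le_iff₀ hn0, div_le_iff₀ (by positivity)]
      refine (hC n h3).trans_eq ?_
      rw [hc]
      have : γ ≠ 0 := by linarith
      field_simp
    rw [Real.dist_eq] at h1
    have := abs_sub_le (h n) (s γ n) (Λ γ)
    linarith
  have hcγ : Tendsto (fun γ : ℝ => c / γ) atTop (𝓝 0) := tendsto_const_nhds.div_atTop tendsto_id
  have hcauchy : CauchySeq h := by
    rw [Metric.cauchySeq_iff]
    intro ε hε
    obtain ⟨γ, hγ1, hγ2⟩ := ((hcγ.eventually (gt_mem_nhds (show 0 < ε / 4 by linarith))).and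
      (eventually_ge_atTop b)).exists
    obtain ⟨N, hN⟩ := eventually_atTop.1 (hclose γ hγ2 (ε / 4) (by linarith))
    refine ⟨N, fun m hm n hn => ?_⟩
    have := abs_sub_le (h m) (Λ γ) (h n)
    rw [abs_sub_comm (Λ γ)] at this
    rw [Real.dist_eq]
    linarith [hN m hm, hN n hn]
  obtain ⟨L, hL⟩ := cauchySeq_tendsto_of_complete hcauchy
  refine ⟨L, Λ, hL, (eventually_ge_atTop b).mono hgr, ?_⟩
  rw [tendsto_iff_dist_tendsto_zero]
  refine squeeze_zero' (Eventually.of_forall fun _ => dist_nonneg) ?_ hcγ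
  filter_upwards [eventually_ge_atTop b] with γ hγ
  refine le_of_forall_pos_le_add fun ε hε => ?_
  have hlim : Tendsto (fun n => |h n - Λ γ|) atTop (𝓝 |L - Λ γ|) := (hL.sub_const _).abs
  rw [dist_comm, Real.dist_eq]
  exact le_of_tendsto hlim ((hclose γ hγ ε hε).mono fun n hn => hn.le)
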